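/- **Proposition (nonexistence for $q\in(1,2]$).** Let $N\ge 3$, $q\in(1,2]$, $\lambda\ge \tfrac12$, and let $\rho\in L^\infty_{\mathrm{loc}}(\mathbb R^N)$ satisfy $\rho(x)\ge 1$ for almost every $x\in\mathbb R^N$. Let $\omega=(N-2)\,|\mathbb S^{N-1}|$, and let $E(\mathbb R^N)$ be the space of real-valued functions $u\in W^{1,1}_{\mathrm{loc}}(\mathbb R^N)$ with $$\|u\|_{E}:=\left(\int_{\mathbb R^N}\bigl(|\nabla u|^2+u^2\bigr)\,dx+\lambda\left(\int_{\mathbb R^N}\int_{\mathbb R^N}\frac{u^2(x)\rho(x)\,u^2(y)\rho(y)}{|x-y|^{N-2}}\,dx\,dy\right)^{1/2}\right)^{1/2}<+\infty .$$ If $u\in E(\mathbb R^N)\cap L^{q+1}(\mathbb R^N)$ satisfies $$-\Delta u+u+\lambda^2\left(\frac{1}{\omega|x|^{N-2}}\star \rho u^2\right)\rho(x)\,u=|u|^{q-1}u\qquad\text{in }\mathcal D'(\mathbb R^N),$$ then $u=0$ almost everywhere in $\mathbb R^N$. -/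

import Mathlib

open MeasureTheory TopologicalSpace
open scoped ENNReal Distributions Laplacian

namespace SchrodingerPoisson

/-- The Euclidean space `ℝ^N`. -/
abbrev Space (N : ℕ) : Type := EuclideanSpace ℝ (Fin N)

/-- Smooth compactly supported real-valued test functions on the whole of `ℝ^N`. -/
abbrev TestFn (N : ℕ) : Type := 𝓓((⊤ : Opens (Space N)), ℝ)

/-- `u ∈ W^{1,1}_loc(ℝ^N)` with weak gradient `G`: both are locally integrable, and
`∫ u ∂ᵢη = - ∫ Gᵢ η` for every test function `η` and every `i`. -/
structure HasWeakGradient {N : ℕ} (u : Space N → ℝ) (G : Space N → Space N) : Prop where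
  locallyIntegrable : LocallyIntegrable u volume
  locallyIntegrable_grad : LocallyIntegrable G volume
  integral_eq : ∀ (η : TestFn N) (i : Fin N),
    ∫ x, u x * fderiv ℝ η x (EuclideanSpace.single i 1) = - ∫ x, G x i * η x

/-- `ρ ∈ L^∞_loc(ℝ^N)`. -/
def MemLinftyLoc {N : ℕ} (ρ : Space N → ℝ) : Prop :=
  ∀ K : Set (Space N), IsCompact K → MemLp ρ ⊤ (volume.restrict K)

/-- The double integral `∬ u²(x) ρ(x) u²(y) ρ(y) / |x - y|^{N-2} dx dy` (for `ρ ≥ 0`, `N ≥ 3`),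
with values in `[0, ∞]`. -/
noncomputable def coulombEnergy {N : ℕ} (ρ u : Space N → ℝ) : ℝ≥0∞ :=
  ∫⁻ x, ∫⁻ y, ENNReal.ofReal (u x ^ 2 * ρ x * (u y ^ 2 * ρ y) / ‖x - y‖ ^ (N - 2))

/-- The norm `‖u‖_E`, with values in `[0, ∞]`, of a function `u` with weak gradient `G`. -/
noncomputable def normE {N : ℕ} (ρ : Space N → ℝ) (lam : ℝ) (u : Space N → ℝ)
    (G : Space N → Space N) : ℝ≥0∞ :=
  ((∫⁻ x, ENNReal.ofReal (‖G x‖ ^ 2 + u x ^ 2)) +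
    ENNReal.ofReal lam * coulombEnergy ρ u ^ (1 / 2 : ℝ)) ^ (1 / 2 : ℝ)

/-- `u ∈ E(ℝ^N)`: `u ∈ W^{1,1}_loc(ℝ^N)` and `‖u‖_E < ∞`
(the weak gradient is unique up to null sets). -/
def MemE {N : ℕ} (ρ : Space N → ℝ) (lam : ℝ) (u : Space N → ℝ) : Prop :=
  ∃ G : Space N → Space N, HasWeakGradient u G ∧ normE ρ lam u G < ⊤

/-- `ω = (N - 2) |𝕊^{N-1}|`. -/
noncomputable def omega (N : ℕ) : ℝ :=
  ((N : ℝ) - 2) * (volume : Measure (Space N)).toSphere.real Set.univ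

/-- The potential `φ_u = (1 / (ω |x|^{N-2})) ⋆ (ρ u²)`, for `N ≥ 3`. -/
noncomputable def potential {N : ℕ} (ρ u : Space N → ℝ) (x : Space N) : ℝ :=
  ∫ y, ρ y * u y ^ 2 / (omega N * ‖x - y‖ ^ (N - 2))

/-- `-Δu + u + λ² φ_u ρ u = |u|^{q-1} u` in `𝓓'(ℝ^N)`, each term acting on test functions by
integration and `Δ` by duality. When `u ∈ E ∩ L^{q+1}` and `ρ ∈ L^∞_loc` is nonnegative and
`N ≥ 3`, all of the terms are locally integrable functions, so that each integral below is an
honest one. -/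
def IsDistributionalSolution {N : ℕ} (ρ : Space N → ℝ) (lam q : ℝ) (u : Space N → ℝ) : Prop :=
  ∀ η : TestFn N,
    - (∫ x, u x * Δ (η : Space N → ℝ) x) + (∫ x, u x * η x)
      + lam ^ 2 * (∫ x, potential ρ u x * ρ x * u x * η x)
      = ∫ x, |u x| ^ (q - 1) * u x * η x

end SchrodingerPoisson

namespace SchrodingerPoisson

open Filter Topology Set

variable {N : ℕ}

/-! Write `D(f)` for the Coulomb energy of a density `f` and `f = ρ u²`. Two inequalities are added.

Testing the equation with `u` gives the Nehari inequality `∫ |∇u|² + ∫ u² + λ² D(f) / ω ≤ ∫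
|u|^(q+1)` (`energy_le`). On the other hand `2λ ∫ ρ |u|³ ≤ ∫ |∇u|² + λ² D(f) / ω`
(`two_mul_integral_mul_abs_le`). Hence `∫ (u² + 2λ ρ |u|³ - |u|^(q+1)) ≤ 0`. Since `2λρ ≥ 1` and `2
< q + 1 ≤ 3`, the integrand is strictly positive wherever `u ≠ 0` (`rpow_lt_sq_add_cube`), so `u =
0` almost everywhere.

The second inequality is usually obtained by testing `-Δφ = f` with `|u|` and applying Young's
inequality. Here it is proved by duality, so that `φ` is never differentiated. The Newtonian kernel
is a superposition of Gaussian autocorrelations, hence positive definite (`two_mul_coul_le`), also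
on signed bounded densities (`coulReal_self_nonneg`). Applied to `-c f - Δg`, and combined with the
fact that the kernel inverts `-Δ` up to the factor `ω` (`integral_newton_mul_laplacian`), positivity
reads `2c ∫ f g ≤ ∫ |∇g|² + c² D(f) / ω`. This is first shown for smooth `g` and bounded `f`, and
then passes to `|u|` and `ρ u²` by approximation and Fatou's lemma.

For the Nehari inequality `u` itself is not an admissible test function. The equation is tested with
a cutoff times a bounded smooth function of a mollification of `u`. Boundedness is essential, since
the nonlinear terms times a cutoff are only known to be in `L¹`. Only an inequality is needed, so
Fatou's lemma suffices for the gradient term. -/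

/-! ### Positivity of the Newtonian kernel -/

/-- The Newtonian kernel `|x|^{-(N-2)}`. -/
noncomputable def newton {N : ℕ} (x : Space N) : ℝ := (‖x‖ ^ (N - 2))⁻¹

/-- The Coulomb pairing of two nonnegative densities. -/
noncomputable def coul {N : ℕ} (f g : Space N → ℝ≥0∞) : ℝ≥0∞ :=
  ∫⁻ x, ∫⁻ y, f x * g y * ENNReal.ofReal (newton (x - y))

lemma newton_nonneg (x : Space N) : 0 ≤ newton x := by unfold newton; positivity

@[fun_prop]
lemma measurable_newton : Measurable (newton (N := N)) := by unfold newton; fun_prop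

lemma newton_neg (x : Space N) : newton (-x) = newton x := by simp [newton]

/-- The total mass of the Gaussian `exp (-4 t |z|²)`. -/
noncomputable def gaussMass (N : ℕ) (t : ℝ) : ℝ≥0∞ :=
  ∫⁻ z : Space N, ENNReal.ofReal (Real.exp (-(4 * t * ‖z‖ ^ 2)))

/-- The Gaussian `exp (-2 t |x|²)` as an extended nonnegative function. -/
noncomputable def gauss (t : ℝ) (x : Space N) : ℝ≥0∞ :=
  ENNReal.ofReal (Real.exp (-(2 * t * ‖x‖ ^ 2)))

@[fun_prop]
lemma measurable_gaussMass : Measurable (gaussMass N) := by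
  unfold gaussMass
  exact Measurable.lintegral_prod_right' (f := fun p : ℝ × Space N =>
    ENNReal.ofReal (Real.exp (-(4 * p.1 * ‖p.2‖ ^ 2)))) (by fun_prop)

lemma gaussMass_ne_top {t : ℝ} (ht : 0 < t) : gaussMass N t ≠ ⊤ := by
  have h := (GaussianFourier.integrable_cexp_neg_mul_sq_norm_add (V := Space N)
    (b := ((4 * t : ℝ) : ℂ)) (by simpa using ht) 0 0).norm
  have h2 : Integrable (fun z : Space N => Real.exp (-(4 * t * ‖z‖ ^ 2))) := by
    refine h.congr (Eventually.of_forall fun z => ?_)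
    simp only [Complex.norm_exp]
    congr 1
    simp [← Complex.ofReal_pow]
  exact (h2.lintegral_lt_top).ne

lemma gaussMass_ne_zero (t : ℝ) : gaussMass N t ≠ 0 := by
  unfold gaussMass
  rw [Ne, lintegral_eq_zero_iff (by fun_prop)]
  intro h
  have h2 : ∀ᵐ _z : Space N, False := by
    filter_upwards [h] with z hz
    simp only [Pi.zero_apply, ENNReal.ofReal_eq_zero] at hz
    exact absurd (Real.exp_pos _) (not_lt.2 hz)
  rw [eventually_false_iff_eq_bot, ae_eq_bot] at h2
  exact NeZero.ne (volume : Measure (Space N)) h2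

lemma norm_sub_sq_add_norm_sub_sq (x y z : Space N) :
    ‖x - z‖ ^ 2 + ‖y - z‖ ^ 2 = 2 * ‖z - (2 : ℝ)⁻¹ • (x + y)‖ ^ 2 + ‖x - y‖ ^ 2 / 2 := by
  simp only [norm_sub_sq_real, norm_smul, mul_pow, norm_add_sq_real, inner_smul_right,
    inner_add_right]
  rw [real_inner_comm z x, real_inner_comm z y]
  norm_num
  ring

/-- Around the midpoint of `x` and `y` the product splits into a factor depending on `x - y` alone
and a Gaussian in `z`, whose mass is translation invariant. -/
lemma lintegral_gauss_mul_gauss (t : ℝ) (x y : Space N) :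
    ∫⁻ z, gauss t (x - z) * gauss t (y - z)
      = ENNReal.ofReal (Real.exp (-(t * ‖x - y‖ ^ 2))) * gaussMass N t := by
  have h : ∀ z : Space N, gauss t (x - z) * gauss t (y - z)
      = ENNReal.ofReal (Real.exp (-(t * ‖x - y‖ ^ 2))) *
        ENNReal.ofReal (Real.exp (-(4 * t * ‖z - (2 : ℝ)⁻¹ • (x + y)‖ ^ 2))) := by
    intro z
    rw [gauss, gauss, ← ENNReal.ofReal_mul (Real.exp_pos _).le,
      ← ENNReal.ofReal_mul (Real.exp_pos _).le, ← Real.exp_add, ← Real.exp_add]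
    congr 2
    linear_combination (-2 * t) * norm_sub_sq_add_norm_sub_sq x y z
  simp_rw [h]
  rw [lintegral_const_mul _ (by fun_prop), gaussMass]
  congr 1
  exact lintegral_sub_right_eq_self (fun z : Space N =>
    ENNReal.ofReal (Real.exp (-(4 * t * ‖z‖ ^ 2)))) _

/-- The weight in the superposition of Gaussians that gives the Newtonian kernel. -/
noncomputable def gaussWeight (N : ℕ) (t : ℝ) : ℝ≥0∞ :=
  ENNReal.ofReal (t ^ (((N : ℝ) - 2) / 2 - 1)) * (gaussMass N t)⁻¹ *
    (ENNReal.ofReal (Real.Gamma (((N : ℝ) - 2) / 2)))⁻¹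

@[fun_prop]
lemma measurable_gaussWeight : Measurable (gaussWeight N) := by
  unfold gaussWeight; fun_prop

@[fun_prop]
lemma measurable_gauss {α : Type*} [MeasurableSpace α] {s : α → ℝ} {f : α → Space N}
    (hs : Measurable s) (hf : Measurable f) :
    Measurable fun a => gauss (s a) (f a) := by
  unfold gauss; fun_prop

/-- This is the Gamma integral `∫ t^(a-1) exp(-t r²) dt = Γ(a) r^(-2a)` with `2a = N - 2`; the
weight divides out `Γ(a)` and the Gaussian mass. The diagonal is excluded because there the left
side is `0⁻¹ = 0` while the right side is infinite. -/
lemma ofReal_newton_eq (hN : 3 ≤ N) {x y : Space N} (hxy : x ≠ y) :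
    ENNReal.ofReal (newton (x - y)) =
      ∫⁻ t in Ioi (0 : ℝ), gaussWeight N t * ∫⁻ z, gauss t (x - z) * gauss t (y - z) := by
  have ha : 0 < ((N : ℝ) - 2) / 2 := by
    have : (3 : ℝ) ≤ N := by exact_mod_cast hN
    linarith
  set a := ((N : ℝ) - 2) / 2 with hadef
  have hr : 0 < ‖x - y‖ ^ 2 := by
    have := norm_pos_iff.2 (sub_ne_zero.2 hxy); positivity
  have hG : 0 < Real.Gamma a := Real.Gamma_pos_of_pos ha
  have hpow : (1 / ‖x - y‖ ^ 2) ^ a = newton (x - y) := by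
    have hpos := norm_pos_iff.2 (sub_ne_zero.2 hxy)
    rw [newton, one_div, Real.inv_rpow hr.le, ← Real.rpow_natCast, ← Real.rpow_mul hpos.le,
      ← Real.rpow_natCast]
    congr 2
    rw [hadef, Nat.cast_sub (by omega)]
    push_cast; ring
  -- Without integrability the Bochner integral would be `0`, against the positive value of the
  -- Gamma integral.
  have hint : IntegrableOn (fun t : ℝ => t ^ (a - 1) * Real.exp (-(‖x - y‖ ^ 2 * t))) (Ioi 0) := by
    by_contra h
    have h1 := Real.integral_rpow_mul_exp_neg_mul_Ioi ha hr
    rw [integral_undef h] at h1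
    have : 0 < (1 / ‖x - y‖ ^ 2) ^ a * Real.Gamma a := by positivity
    linarith
  have hstep : ∀ t ∈ Ioi (0 : ℝ),
      gaussWeight N t * ∫⁻ z, gauss t (x - z) * gauss t (y - z) =
      (ENNReal.ofReal (Real.Gamma a))⁻¹ *
        ENNReal.ofReal (t ^ (a - 1) * Real.exp (-(‖x - y‖ ^ 2 * t))) := by
    intro t ht
    rw [lintegral_gauss_mul_gauss, gaussWeight, ← hadef,
      ENNReal.ofReal_mul (Real.rpow_nonneg (le_of_lt ht) _), mul_comm (‖x - y‖ ^ 2) t]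
    have hc := ENNReal.inv_mul_cancel (gaussMass_ne_zero (N := N) t) (gaussMass_ne_top ht)
    calc _ = (ENNReal.ofReal (Real.Gamma a))⁻¹ * (ENNReal.ofReal (t ^ (a - 1)) *
          ENNReal.ofReal (Real.exp (-(t * ‖x - y‖ ^ 2)))) *
          ((gaussMass N t)⁻¹ * gaussMass N t) := by ring
      _ = _ := by rw [hc, mul_one]
  rw [setLIntegral_congr_fun measurableSet_Ioi hstep, lintegral_const_mul _ (by fun_prop),
    ← ofReal_integral_eq_lintegral_ofReal hint, Real.integral_rpow_mul_exp_neg_mul_Ioi ha hr, hpow,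
    ENNReal.ofReal_mul (newton_nonneg _), mul_comm (ENNReal.ofReal (newton _)), ← mul_assoc,
    ENNReal.inv_mul_cancel (by simpa using hG) ENNReal.ofReal_ne_top, one_mul]
  filter_upwards [ae_restrict_mem measurableSet_Ioi] with t ht
  exact mul_nonneg (Real.rpow_nonneg (le_of_lt ht) _) (Real.exp_pos _).le

lemma nontrivial_space (hN : 3 ≤ N) : Nontrivial (Space N) := by
  have : Nonempty (Fin N) := ⟨⟨0, by omega⟩⟩
  infer_instance

/-- Tonelli's theorem applied to the Gaussian superposition; the exceptional diagonal is null. With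
`f = g` the right side becomes a weighted integral of squares, which is the source of positivity. -/
lemma coul_eq (hN : 3 ≤ N) {f g : Space N → ℝ≥0∞} (hf : Measurable f) (hg : Measurable g) :
    coul f g = ∫⁻ t in Ioi (0 : ℝ), ∫⁻ z, gaussWeight N t *
      ((∫⁻ x, f x * gauss t (x - z)) * ∫⁻ y, g y * gauss t (y - z)) := by
  have := nontrivial_space hN
  have h1 : coul f g = ∫⁻ x, ∫⁻ y, ∫⁻ t in Ioi (0 : ℝ), ∫⁻ z,
      gaussWeight N t * ((f x * gauss t (x - z)) * (g y * gauss t (y - z))) := by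
    unfold coul
    refine lintegral_congr fun x => lintegral_congr_ae ?_
    filter_upwards [(measure_eq_zero_iff_ae_notMem.1 (measure_singleton (μ := volume) x))]
      with y hy
    rw [ofReal_newton_eq hN (fun h => hy (by simp [h])), ← lintegral_const_mul _ (by fun_prop)]
    refine lintegral_congr fun t => ?_
    rw [← mul_assoc, ← lintegral_const_mul _ (by fun_prop)]
    exact lintegral_congr fun z => by ring
  have h2 : ∀ x, (∫⁻ y, ∫⁻ t in Ioi (0 : ℝ), ∫⁻ z,
      gaussWeight N t * ((f x * gauss t (x - z)) * (g y * gauss t (y - z)))) =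
      ∫⁻ t in Ioi (0 : ℝ), ∫⁻ z, gaussWeight N t * ((f x * gauss t (x - z)) *
        ∫⁻ y, g y * gauss t (y - z)) := by
    intro x
    rw [lintegral_lintegral_swap]
    · refine lintegral_congr fun t => ?_
      rw [lintegral_lintegral_swap (by fun_prop)]
      refine lintegral_congr fun z => ?_
      rw [lintegral_const_mul _ (by fun_prop), lintegral_const_mul _ (by fun_prop)]
    · refine Measurable.aemeasurable ?_
      exact Measurable.lintegral_prod_right' (f := fun p : (Space N × ℝ) × Space N =>
        gaussWeight N p.1.2 * ((f x * gauss p.1.2 (x - p.2)) *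
          (g p.1.1 * gauss p.1.2 (p.1.1 - p.2)))) (by fun_prop)
  have hg' : Measurable fun p : ℝ × Space N => ∫⁻ y, g y * gauss p.1 (y - p.2) :=
    Measurable.lintegral_prod_right' (f := fun q : (ℝ × Space N) × Space N =>
      g q.2 * gauss q.1.1 (q.2 - q.1.2)) (by fun_prop)
  rw [h1]
  simp_rw [h2]
  rw [lintegral_lintegral_swap]
  · refine lintegral_congr fun t => ?_
    have hg2 : Measurable fun z : Space N => ∫⁻ y, g y * gauss t (y - z) :=
      hg'.comp (measurable_const.prodMk measurable_id)
    rw [lintegral_lintegral_swap (by fun_prop)]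
    refine lintegral_congr fun z => ?_
    rw [lintegral_const_mul _ (by fun_prop), lintegral_mul_const _ (by fun_prop)]
  · refine Measurable.aemeasurable ?_
    refine Measurable.lintegral_prod_right' (f := fun p : (Space N × ℝ) × Space N =>
        gaussWeight N p.1.2 * ((f p.1.1 * gauss p.1.2 (p.1.1 - p.2)) *
          ∫⁻ y, g y * gauss p.1.2 (y - p.2))) ?_
    have hg3 : Measurable fun p : (Space N × ℝ) × Space N =>
        ∫⁻ y, g y * gauss p.1.2 (y - p.2) :=
      hg'.comp (f := fun p : (Space N × ℝ) × Space N => (p.1.2, p.2)) (by fun_prop)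
    fun_prop

lemma ennreal_two_mul_le (a b : ℝ≥0∞) : 2 * (a * b) ≤ a * a + b * b := by
  by_cases ha : a = ⊤
  · simp [ha]
  by_cases hb : b = ⊤
  · simp [hb]
  lift a to NNReal using ha
  lift b to NNReal using hb
  norm_cast
  have := two_mul_le_add_sq a b
  simpa [sq, mul_assoc] using this

/-- The Newtonian kernel is positive definite. -/
theorem two_mul_coul_le (hN : 3 ≤ N) {f g : Space N → ℝ≥0∞} (hf : Measurable f)
    (hg : Measurable g) : 2 * coul f g ≤ coul f f + coul g g := by
  have key : ∀ {h : Space N → ℝ≥0∞}, Measurable h →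
      Measurable fun p : ℝ × Space N => ∫⁻ y, h y * gauss p.1 (y - p.2) := fun {h} hh =>
    Measurable.lintegral_prod_right' (f := fun q : (ℝ × Space N) × Space N =>
      h q.2 * gauss q.1.1 (q.2 - q.1.2)) (by fun_prop)
  rw [coul_eq hN hf hg, coul_eq hN hf hf, coul_eq hN hg hg]
  have hf' := key hf
  have hg' := key hg
  have hm : ∀ {a b : ℝ × Space N → ℝ≥0∞}, Measurable a → Measurable b →
      Measurable fun p : ℝ × Space N => gaussWeight N p.1 * (a p * b p) := by
    intro a b ha hb; fun_prop
  rw [← lintegral_const_mul _ (hm hf' hg').lintegral_prod_right',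
    ← lintegral_add_left (hm hf' hf').lintegral_prod_right']
  -- What remains is `2ab ≤ a² + b²`, pointwise in `(t, z)`, for the Gaussian averages of `f` and
  -- `g`.
  refine lintegral_mono fun t => ?_
  have hx : ∀ {a : ℝ × Space N → ℝ≥0∞}, Measurable a → Measurable fun z => a (t, z) :=
    fun ha => ha.comp (measurable_const.prodMk measurable_id)
  dsimp only
  rw [← lintegral_const_mul _ (hx (hm hf' hg')), ← lintegral_add_left (hx (hm hf' hf'))]
  refine lintegral_mono fun z => ?_
  dsimp only
  rw [← mul_add, mul_left_comm]
  gcongr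
  exact ennreal_two_mul_le _ _

/-! ### Local integrability of the Newtonian kernel -/

/-- In polar coordinates the integrand becomes `r ^ (N - 1 - m)`, a nonnegative power. Besides the
kernel (`m = N - 2`), the case `m = N - 1` is needed for its gradient. -/
lemma integrableOn_ball_inv_norm_pow (hN : 3 ≤ N) {m : ℕ} (hm : m < N) (R : ℝ) :
    IntegrableOn (fun x : Space N => (‖x‖ ^ m)⁻¹) (Metric.ball 0 R) := by
  have := nontrivial_space hN
  rw [integrableOn_fun_norm_addHaar volume (f := fun r : ℝ => (r ^ m)⁻¹), finrank_euclideanSpace,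
    Fintype.card_fin]
  have h : IntegrableOn (fun y : ℝ => y ^ (N - 1 - m)) (Ioo 0 R) :=
    ((continuous_pow _).integrableOn_Icc (a := 0) (b := R)).mono_set Ioo_subset_Icc_self
  refine h.congr_fun (fun y hy => ?_) measurableSet_Ioo
  have hy0 : y ≠ 0 := hy.1.ne'
  simp only [smul_eq_mul]
  rw [pow_sub₀ _ hy0 (by omega)]

lemma integrableOn_ball_newton (hN : 3 ≤ N) (R : ℝ) :
    IntegrableOn (newton (N := N)) (Metric.ball 0 R) :=
  integrableOn_ball_inv_norm_pow hN (by omega) R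

lemma coul_mono {f f' g g' : Space N → ℝ≥0∞} (hf : ∀ x, f x ≤ f' x) (hg : ∀ x, g x ≤ g' x) :
    coul f g ≤ coul f' g' := by
  unfold coul
  gcongr with x y
  · exact hf x
  · exact hg y

/-- After the change of variable `y ↦ x - y` the inner integral is bounded by the integral of the
kernel over the ball of radius `2R`, uniformly in `x`. -/
lemma coul_lt_top (hN : 3 ≤ N) {f : Space N → ℝ≥0∞} {C : ℝ≥0∞} (hC : C ≠ ⊤) {R : ℝ}
    (hf : ∀ x, f x ≤ (Metric.ball (0 : Space N) R).indicator (fun _ => C) x) : coul f f < ⊤ := by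
  set B := Metric.ball (0 : Space N) R with hB
  have hI : ∫⁻ z in Metric.ball (0 : Space N) (R + R), ENNReal.ofReal (newton z) < ⊤ :=
    (integrableOn_ball_newton hN (R + R)).lintegral_lt_top
  set I := ∫⁻ z in Metric.ball (0 : Space N) (R + R), ENNReal.ofReal (newton z) with hIdef
  have h1 : coul f f ≤ ∫⁻ x, B.indicator (fun _ => C * C * I) x := by
    unfold coul
    refine lintegral_mono fun x => ?_
    by_cases hx : x ∈ B
    · rw [indicator_of_mem hx, hIdef, ← lintegral_indicator measurableSet_ball,
        ← lintegral_const_mul _ ((by fun_prop : Measurable fun z : Space N =>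
          ENNReal.ofReal (newton z)).indicator measurableSet_ball),
        ← lintegral_sub_left_eq_self _ x]
      refine lintegral_mono fun y => ?_
      by_cases hy : x - y ∈ B
      · have : y ∈ Metric.ball (0 : Space N) (R + R) := by
          simp only [hB, mem_ball_zero_iff] at hx hy ⊢
          have := norm_sub_le x (x - y)
          rw [sub_sub_cancel] at this
          exact this.trans_lt (add_lt_add hx hy)
        rw [indicator_of_mem this, sub_sub_cancel]
        gcongr
        · simpa [hx] using hf x
        · simpa [hy] using hf (x - y)
      · have : f (x - y) = 0 := by simpa [hy] using hf (x - y)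
        simp [this]
    · have : f x = 0 := by simpa [hx] using hf x
      simp [this]
  refine h1.trans_lt ?_
  rw [lintegral_indicator measurableSet_ball, setLIntegral_const]
  exact ENNReal.mul_lt_top (ENNReal.mul_lt_top (ENNReal.mul_lt_top hC.lt_top hC.lt_top) hI)
    measure_ball_lt_top

/-- A locally bounded, compactly supported factor makes a function that is integrable on balls
integrable. -/
lemma integrable_mul_of_hasCompactSupport {k g : Space N → ℝ}
    (hk : ∀ R : ℝ, IntegrableOn k (Metric.ball 0 R))
    (hg : Continuous g) (hgs : HasCompactSupport g) : Integrable fun x => k x * g x := by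
  obtain ⟨R, hR⟩ := hgs.isCompact.isBounded.subset_ball 0
  obtain ⟨C, hC⟩ := hg.bounded_above_of_compact_support hgs
  have h1 : IntegrableOn (fun x => k x * g x) (Metric.ball 0 R) :=
    (hk R).mul_bdd (c := C) hg.aestronglyMeasurable (Eventually.of_forall hC)
  refine (integrableOn_iff_integrable_of_support_subset fun x hx => ?_).1 h1
  exact hR (subset_tsupport _ (right_ne_zero_of_mul hx))

/-! ### The fundamental solution of the Laplacian -/

/-- The `i`-th vector of the standard basis of `ℝ^N`. -/
noncomputable abbrev basisVec (i : Fin N) : Space N := EuclideanSpace.single i 1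

lemma laplacian_eq_sum {g : Space N → ℝ} (hg : ContDiff ℝ 2 g) (x : Space N) :
    Δ g x = ∑ i, fderiv ℝ (fun y => fderiv ℝ g y (basisVec i)) x (basisVec i) := by
  rw [InnerProductSpace.laplacian_eq_iteratedFDeriv_orthonormalBasis g
    (EuclideanSpace.basisFun (Fin N) ℝ)]
  refine Finset.sum_congr rfl fun i _ => ?_
  have hd : DifferentiableAt ℝ (fderiv ℝ g) x :=
    ((hg.fderiv_right (m := 1) (by norm_num)).differentiable (by norm_num)) x
  rw [iteratedFDeriv_two_apply, fderiv_clm_apply hd (by fun_prop)]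
  simp

lemma continuous_laplacian {g : Space N → ℝ} (hg : ContDiff ℝ 2 g) : Continuous (Δ g) := by
  have : Δ g = fun x => ∑ i, fderiv ℝ (fun y => fderiv ℝ g y (basisVec i)) x (basisVec i) :=
    funext (laplacian_eq_sum hg)
  rw [this]
  refine continuous_finsetSum _ fun i _ => ?_
  have h1 : ContDiff ℝ 1 (fun y => fderiv ℝ g y (basisVec i)) :=
    (hg.fderiv_right (m := 1) (by norm_num)).clm_apply contDiff_const
  exact (h1.continuous_fderiv (by norm_num)).clm_apply continuous_const

lemma hasCompactSupport_fderiv_apply {g : Space N → ℝ} (hg : HasCompactSupport g) (v : Space N) :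
    HasCompactSupport fun x => fderiv ℝ g x v :=
  (hg.fderiv (𝕜 := ℝ)).comp_left (g := fun L : Space N →L[ℝ] ℝ => L v) (by simp)

lemma hasCompactSupport_laplacian {g : Space N → ℝ} (hg : ContDiff ℝ 2 g)
    (hgs : HasCompactSupport g) : HasCompactSupport (Δ g) := by
  have : Δ g = fun x => ∑ i, fderiv ℝ (fun y => fderiv ℝ g y (basisVec i)) x (basisVec i) :=
    funext (laplacian_eq_sum hg)
  rw [this]
  refine hgs.mono' ?_
  intro x hx
  obtain ⟨i, -, hi⟩ := Finset.exists_ne_zero_of_sum_ne_zero hx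
  have h1 : x ∈ tsupport (fun x => fderiv ℝ (fun y => fderiv ℝ g y (basisVec i)) x (basisVec i)) :=
    subset_tsupport _ hi
  exact (tsupport_fderiv_apply_subset ℝ _).trans (tsupport_fderiv_apply_subset ℝ _) h1

lemma clm_apply_eq_sum (L : Space N →L[ℝ] ℝ) (x : Space N) : L x = ∑ i, x i * L (basisVec i) := by
  have h : x = ∑ i, x i • basisVec i := by
    conv_lhs => rw [← (EuclideanSpace.basisFun (Fin N) ℝ).sum_repr x]
    simp
  conv_lhs => rw [congrArg L h]
  simp

lemma fderiv_apply_self (g : Space N → ℝ) (x : Space N) :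
    fderiv ℝ g x x = ∑ i, x i * fderiv ℝ g x (basisVec i) := clm_apply_eq_sum _ x

/-- The regularised Newtonian kernel. -/
noncomputable def newtonReg (N : ℕ) (ε : ℝ) (x : Space N) : ℝ :=
  (‖x‖ ^ 2 + ε ^ 2) ^ (-(((N : ℝ) - 2) / 2))

lemma hasFDerivAt_newtonReg {ε : ℝ} (hε : 0 < ε) (x : Space N) :
    HasFDerivAt (newtonReg N ε) ((-((N : ℝ) - 2) * (‖x‖ ^ 2 + ε ^ 2) ^ (-((N : ℝ) / 2))) •
      innerSL ℝ x) x := by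
  have h1 : HasFDerivAt (fun x : Space N => ‖x‖ ^ 2 + ε ^ 2) (2 • innerSL ℝ x) x :=
    ((hasStrictFDerivAt_norm_sq x).hasFDerivAt).add_const _
  have h2 := h1.rpow_const (p := -(((N : ℝ) - 2) / 2)) (Or.inl (by positivity))
  refine h2.congr_fderiv ?_
  ext v
  have : -(((N : ℝ) - 2) / 2) - 1 = -((N : ℝ) / 2) := by ring
  simp only [this, smul_apply, smul_eq_mul, nsmul_eq_mul]
  push_cast
  ring

lemma continuous_newtonReg {ε : ℝ} (hε : 0 < ε) : Continuous (newtonReg N ε) :=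
  continuous_iff_continuousAt.2 fun x => (hasFDerivAt_newtonReg hε x).continuousAt

/-- One integration by parts per coordinate; the gradient of the regularised kernel is radial, so
only the radial derivative of `g` survives. -/
lemma integral_newtonReg_mul_laplacian {g : Space N → ℝ} (hg : ContDiff ℝ 2 g)
    (hgs : HasCompactSupport g) {ε : ℝ} (hε : 0 < ε) :
    ∫ x, newtonReg N ε x * Δ g x =
      ((N : ℝ) - 2) * ∫ x, (‖x‖ ^ 2 + ε ^ 2) ^ (-((N : ℝ) / 2)) * fderiv ℝ g x x := by
  have hc : ∀ i : Fin N, ContDiff ℝ 1 (fun y => fderiv ℝ g y (basisVec i)) := fun i =>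
    (hg.fderiv_right (m := 1) (by norm_num)).clm_apply contDiff_const
  have hcs : ∀ i : Fin N, HasCompactSupport (fun y => fderiv ℝ g y (basisVec i)) := fun i =>
    hasCompactSupport_fderiv_apply hgs _
  have hk := continuous_newtonReg (N := N) hε
  have hw : Continuous fun x : Space N => (‖x‖ ^ 2 + ε ^ 2) ^ (-((N : ℝ) / 2)) := by
    refine Continuous.rpow_const (by fun_prop) fun x => Or.inl (by positivity)
  have hdi : ∀ i : Fin N, Continuous fun x =>
      fderiv ℝ (fun y => fderiv ℝ g y (basisVec i)) x (basisVec i) := fun i =>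
    ((hc i).continuous_fderiv (by norm_num)).clm_apply continuous_const
  have hi1 : ∀ i : Fin N, Integrable fun x => newtonReg N ε x *
      fderiv ℝ (fun y => fderiv ℝ g y (basisVec i)) x (basisVec i) := fun i =>
    (hk.mul (hdi i)).integrable_of_hasCompactSupport
      ((hasCompactSupport_fderiv_apply (hcs i) _).mul_left)
  have hf : ∀ x : Space N, ∀ i, fderiv ℝ (newtonReg N ε) x (basisVec i) =
      -((N : ℝ) - 2) * ((‖x‖ ^ 2 + ε ^ 2) ^ (-((N : ℝ) / 2)) * x i) := by
    intro x i
    rw [(hasFDerivAt_newtonReg hε x).fderiv]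
    simp [mul_assoc, EuclideanSpace.inner_single_right]
  have hi2 : ∀ i : Fin N, Integrable fun x => (‖x‖ ^ 2 + ε ^ 2) ^ (-((N : ℝ) / 2)) *
      (x i * fderiv ℝ g x (basisVec i)) := fun i =>
    (hw.mul ((by fun_prop : Continuous fun x : Space N => x i).mul (hc i).continuous)
      ).integrable_of_hasCompactSupport ((hcs i).mul_left.mul_left)
  simp_rw [laplacian_eq_sum hg, fderiv_apply_self, Finset.mul_sum]
  rw [integral_finsetSum _ fun i _ => hi1 i, integral_finsetSum _ fun i _ => hi2 i,
    Finset.mul_sum]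
  refine Finset.sum_congr rfl fun i _ => ?_
  rw [integral_mul_fderiv_eq_neg_fderiv_mul_of_integrable _ (hi1 i)]
  · simp_rw [hf]
    rw [← integral_neg, ← integral_const_mul]
    congr 1 with x
    ring
  · exact (hk.mul (hc i).continuous).integrable_of_hasCompactSupport (hcs i).mul_left
  · exact fun x _ => (hasFDerivAt_newtonReg hε x).differentiableAt
  · exact fun x _ => ((hc i).differentiable (by norm_num)) x
  · simp_rw [hf]
    convert (hi2 i).const_mul (-((N : ℝ) - 2)) using 2 with x
    ring

lemma tendsto_norm_sq_add_rpow {x : Space N} (hx : x ≠ 0) (p : ℝ) :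
    Tendsto (fun n : ℕ => (‖x‖ ^ 2 + (1 / ((n : ℝ) + 1)) ^ 2) ^ p) atTop
      (𝓝 ((‖x‖ ^ 2) ^ p)) := by
  have hpos := norm_pos_iff.2 hx
  have h1 : Tendsto (fun n : ℕ => ‖x‖ ^ 2 + (1 / ((n : ℝ) + 1)) ^ 2) atTop
      (𝓝 (‖x‖ ^ 2 + 0 ^ 2)) :=
    tendsto_const_nhds.add (tendsto_one_div_add_atTop_nhds_zero_nat.pow 2)
  have h2 := h1.rpow_const (p := p) (Or.inl (by positivity))
  simpa using h2

lemma norm_sq_rpow_neg_half {x : Space N} (m : ℕ) :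
    (‖x‖ ^ 2) ^ (-((m : ℝ) / 2)) = (‖x‖ ^ m)⁻¹ := by
  rw [← Real.rpow_natCast, ← Real.rpow_natCast, ← Real.rpow_mul (norm_nonneg _),
    ← Real.rpow_neg (norm_nonneg _)]
  congr 1
  push_cast; ring

lemma ae_ne_zero (hN : 3 ≤ N) : ∀ᵐ x : Space N, x ≠ 0 := by
  have := nontrivial_space hN
  filter_upwards [measure_eq_zero_iff_ae_notMem.1 (measure_singleton (μ := volume) (0 : Space N))]
    with x hx h using hx h

/-- The regularisation is removed by dominated convergence. The majorants are `|x|^{-(N-2)} |Δg|`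
and `|x|^{-(N-1)} |∇g|`; the second uses that the factor `x` in the radial derivative gains one
power of `|x|`. -/
lemma integral_newton_mul_laplacian_eq (hN : 3 ≤ N) {g : Space N → ℝ} (hg : ContDiff ℝ 2 g)
    (hgs : HasCompactSupport g) :
    (Integrable fun x : Space N => (‖x‖ ^ N)⁻¹ * fderiv ℝ g x x) ∧
    ∫ x, newton x * Δ g x = ((N : ℝ) - 2) * ∫ x, (‖x‖ ^ N)⁻¹ * fderiv ℝ g x x := by
  have hcd : Continuous (fderiv ℝ g) := hg.continuous_fderiv (by norm_num)
  have hmeas : ∀ p : ℝ, ∀ ε : ℝ, Measurable fun x : Space N => (‖x‖ ^ 2 + ε ^ 2) ^ p := by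
    intro p ε; fun_prop
  have hgx : Continuous fun x : Space N => fderiv ℝ g x x := hcd.clm_apply continuous_id
  have hb1 : Integrable fun x : Space N => newton x * ‖Δ g x‖ :=
    integrable_mul_of_hasCompactSupport (integrableOn_ball_newton hN)
      (continuous_laplacian hg).norm (hasCompactSupport_laplacian hg hgs).norm
  have hb2 : Integrable fun x : Space N => (‖x‖ ^ (N - 1))⁻¹ * ‖fderiv ℝ g x‖ :=
    integrable_mul_of_hasCompactSupport
      (integrableOn_ball_inv_norm_pow hN (by omega)) hcd.norm (hgs.fderiv (𝕜 := ℝ)).norm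
  have hbd : ∀ x : Space N, x ≠ 0 → (‖x‖ ^ N)⁻¹ * ‖fderiv ℝ g x x‖ ≤
      (‖x‖ ^ (N - 1))⁻¹ * ‖fderiv ℝ g x‖ := by
    intro x hx
    have hpos := norm_pos_iff.2 hx
    have h1 := (fderiv ℝ g x).le_opNorm x
    have h2 : (‖x‖ ^ N)⁻¹ * ‖x‖ = (‖x‖ ^ (N - 1))⁻¹ := by
      obtain ⟨m, rfl⟩ : ∃ m, N = m + 1 := ⟨N - 1, by omega⟩
      simp only [Nat.add_sub_cancel, pow_succ]
      field_simp
    calc (‖x‖ ^ N)⁻¹ * ‖fderiv ℝ g x x‖ ≤ (‖x‖ ^ N)⁻¹ * (‖fderiv ℝ g x‖ * ‖x‖) := by gcongr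
      _ = _ := by rw [← h2]; ring
  have hmono : ∀ x : Space N, x ≠ 0 → ∀ (m : ℕ) (ε : ℝ), (‖x‖ ^ 2 + ε ^ 2) ^ (-((m : ℝ) / 2)) ≤
      (‖x‖ ^ m)⁻¹ := by
    intro x hx m ε
    have hpos := norm_pos_iff.2 hx
    rw [← norm_sq_rpow_neg_half]
    refine Real.rpow_le_rpow_of_nonpos (by positivity) (by nlinarith [sq_nonneg ε]) ?_
    rw [neg_nonpos]; positivity
  have hcast : ((N : ℝ) - 2) = ((N - 2 : ℕ) : ℝ) := by
    rw [Nat.cast_sub (by omega)]; norm_num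
  refine ⟨hb2.mono' ((by fun_prop : Measurable fun x : Space N =>
    (‖x‖ ^ N)⁻¹).aestronglyMeasurable.mul hgx.aestronglyMeasurable) ?_, ?_⟩
  · filter_upwards [ae_ne_zero hN] with x hx
    rw [norm_mul, norm_inv, norm_pow, norm_norm]
    exact hbd x hx
  have hT1 : Tendsto (fun n : ℕ => ∫ x, newtonReg N (1 / ((n : ℝ) + 1)) x * Δ g x) atTop
      (𝓝 (∫ x, newton x * Δ g x)) := by
    refine tendsto_integral_of_dominated_convergence _ (fun n => ?_) hb1 (fun n => ?_) ?_
    · exact (hmeas _ _).aestronglyMeasurable.mul (continuous_laplacian hg).aestronglyMeasurable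
    · filter_upwards [ae_ne_zero hN] with x hx
      rw [norm_mul]
      gcongr
      rw [newtonReg, Real.norm_of_nonneg (by positivity), newton, hcast]
      exact hmono x hx _ _
    · filter_upwards [ae_ne_zero hN] with x hx
      refine Tendsto.mul_const _ ?_
      rw [newton, ← norm_sq_rpow_neg_half, ← hcast]
      exact tendsto_norm_sq_add_rpow hx _
  have hT2 : Tendsto (fun n : ℕ => ∫ x : Space N,
      (‖x‖ ^ 2 + (1 / ((n : ℝ) + 1)) ^ 2) ^ (-((N : ℝ) / 2)) * fderiv ℝ g x x) atTop
      (𝓝 (∫ x, (‖x‖ ^ N)⁻¹ * fderiv ℝ g x x)) := by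
    refine tendsto_integral_of_dominated_convergence _ (fun n => ?_) hb2 (fun n => ?_) ?_
    · exact (hmeas _ _).aestronglyMeasurable.mul hgx.aestronglyMeasurable
    · filter_upwards [ae_ne_zero hN] with x hx
      refine le_trans ?_ (hbd x hx)
      rw [norm_mul]
      gcongr
      rw [Real.norm_of_nonneg (by positivity)]
      exact hmono x hx _ _
    · filter_upwards [ae_ne_zero hN] with x hx
      refine Tendsto.mul_const _ ?_
      rw [← norm_sq_rpow_neg_half]
      exact tendsto_norm_sq_add_rpow hx _
  refine tendsto_nhds_unique hT1 ?_
  refine (hT2.const_mul ((N : ℝ) - 2)).congr fun n => ?_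
  rw [integral_newtonReg_mul_laplacian hg hgs (by positivity)]

/-- In polar coordinates the Jacobian `r^(N-1)` and the factor `r` from the radial derivative cancel
`r^(-N)`. Each ray then contributes `∫₀^∞ d/dr g(rs) dr = -g(0)`. -/
lemma integral_radial_fderiv (hN : 3 ≤ N) {g : Space N → ℝ} (hg : ContDiff ℝ 1 g)
    (hgs : HasCompactSupport g)
    (hint : Integrable fun x : Space N => (‖x‖ ^ N)⁻¹ * fderiv ℝ g x x) :
    ∫ x, (‖x‖ ^ N)⁻¹ * fderiv ℝ g x x =
      - (volume : Measure (Space N)).toSphere.real univ * g 0 := by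
  have := nontrivial_space hN
  set μ := (volume : Measure (Space N))
  set F : Space N → ℝ := fun x => (‖x‖ ^ N)⁻¹ * fderiv ℝ g x x with hF
  have hmp := μ.measurePreserving_homeomorphUnitSphereProd
  have hme := (homeomorphUnitSphereProd (Space N)).measurableEmbedding
  set H : Metric.sphere (0 : Space N) 1 × Ioi (0 : ℝ) → ℝ := fun p => F (p.2.1 • p.1.1) with hH
  have hHF : ∀ x : ({0}ᶜ : Set (Space N)), H (homeomorphUnitSphereProd (Space N) x) = F x := by
    intro x
    have := congrArg Subtype.val ((homeomorphUnitSphereProd (Space N)).symm_apply_apply x)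
    rw [homeomorphUnitSphereProd_symm_apply_coe] at this
    simp only [hH]
    rw [this]
  have h1 : ∫ x, F x ∂μ = ∫ p, H p ∂(μ.toSphere.prod (.volumeIoiPow (Module.finrank ℝ (Space N) - 1))) := by
    rw [← hmp.integral_comp hme]
    simp_rw [hHF]
    rw [integral_subtype_comap (measurableSet_singleton _).compl F, restrict_compl_singleton]
  have h2 : Integrable H (μ.toSphere.prod (.volumeIoiPow (Module.finrank ℝ (Space N) - 1))) := by
    rw [← hmp.integrable_comp_emb hme]
    have : H ∘ (homeomorphUnitSphereProd (Space N)) = F ∘ Subtype.val := funext hHF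
    rw [this, ← integrableOn_iff_comap_subtypeVal (measurableSet_singleton _).compl]
    exact hint.integrableOn
  rw [h1, integral_prod _ h2]
  have h3 : ∀ s : Metric.sphere (0 : Space N) 1,
      ∫ r, H (s, r) ∂(Measure.volumeIoiPow (Module.finrank ℝ (Space N) - 1)) = - g 0 := by
    intro s
    have hs : ‖(s : Space N)‖ = 1 := by simp
    have hd : ∀ r : ℝ, HasDerivAt (fun r : ℝ => g (r • (s : Space N)))
        (fderiv ℝ g (r • (s : Space N)) s) r := by
      intro r
      have ha : HasDerivAt (fun r : ℝ => r • (s : Space N)) (s : Space N) r := by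
        simpa using (hasDerivAt_id r).smul_const (s : Space N)
      exact ((hg.differentiable (by norm_num)) _).hasFDerivAt.comp_hasDerivAt r ha
    have hcs : HasCompactSupport (fun r : ℝ => g (r • (s : Space N))) := by
      refine hgs.comp_isClosedEmbedding (g := fun r : ℝ => r • (s : Space N)) ?_
      refine (AddMonoidHomClass.isometry_of_norm
        (LinearMap.toSpanSingleton ℝ (Space N) (s : Space N)) fun r => ?_).isClosedEmbedding
      simp [norm_smul, hs]
    have hcd : ContDiff ℝ 1 (fun r : ℝ => g (r • (s : Space N))) := by fun_prop
    have h4 := hcs.integral_Ioi_deriv_eq hcd 0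
    have h5 : deriv (fun r : ℝ => g (r • (s : Space N))) =
        fun r => fderiv ℝ g (r • (s : Space N)) s := funext fun r => (hd r).deriv
    rw [h5] at h4
    simp only [zero_smul] at h4
    rw [← h4, Measure.volumeIoiPow]
    simp only [ENNReal.ofReal]
    rw [integral_withDensity_eq_integral_smul
      (measurable_subtype_coe.pow_const _).real_toNNReal,
      integral_subtype_comap measurableSet_Ioi fun a : ℝ =>
        Real.toNNReal (a ^ (Module.finrank ℝ (Space N) - 1)) • F (a • (s : Space N))]
    refine setIntegral_congr_fun measurableSet_Ioi fun r hr => ?_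
    have hr' : (0 : ℝ) < r := hr
    rw [NNReal.smul_def, Real.coe_toNNReal _ (pow_nonneg hr'.le _), smul_eq_mul, hF,
      finrank_euclideanSpace, Fintype.card_fin]
    simp only [norm_smul, hs, mul_one, Real.norm_of_nonneg hr'.le, map_smul, smul_eq_mul]
    obtain ⟨m, rfl⟩ : ∃ m, N = m + 1 := ⟨N - 1, by omega⟩
    simp only [Nat.add_sub_cancel, pow_succ]
    field_simp
  simp_rw [h3]
  simp [μ]

/-- `|x|^{-(N-2)} / ω` is the fundamental solution of `-Δ`. -/
theorem integral_newton_mul_laplacian (hN : 3 ≤ N) {g : Space N → ℝ} (hg : ContDiff ℝ 2 g)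
    (hgs : HasCompactSupport g) (x : Space N) :
    ∫ y, newton (x - y) * Δ g y = - omega N * g x := by
  set g' : Space N → ℝ := fun z => g (x + z) with hg'
  have hc : ContDiff ℝ 2 g' := by fun_prop
  have hs : HasCompactSupport g' := hgs.comp_homeomorph (Homeomorph.addLeft x)
  have h1 : ∀ z, Δ g' z = Δ g (x + z) := by
    intro z
    rw [laplacian_eq_sum hc, laplacian_eq_sum hg]
    refine Finset.sum_congr rfl fun i _ => ?_
    have : (fun y => fderiv ℝ g' y (basisVec i)) =
        fun y => (fun w => fderiv ℝ g w (basisVec i)) (x + y) := by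
      funext y
      rw [hg', fderiv_comp_add_left]
    rw [this, fderiv_comp_add_left (f := fun w => fderiv ℝ g w (basisVec i))]
  obtain ⟨hi, he⟩ := integral_newton_mul_laplacian_eq hN hc hs
  rw [integral_radial_fderiv hN (hc.of_le (by norm_num)) hs hi] at he
  rw [← integral_add_left_eq_self _ x]
  have : ∀ z, newton (x - (x + z)) * Δ g (x + z) = newton z * Δ g' z := by
    intro z
    rw [h1, sub_add_cancel_left, newton_neg]
  simp_rw [this]
  rw [he, omega]
  simp only [hg', add_zero]
  ring

/-! ### The dual estimate for bounded densities -/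

/-- Bounded measurable functions that vanish outside a ball. -/
def BddSupp (p : Space N → ℝ) : Prop :=
  Measurable p ∧ ∃ C R : ℝ, 0 ≤ C ∧ ∀ x, |p x| ≤ (Metric.ball 0 R).indicator (fun _ => C) x

/-- The Coulomb pairing of signed densities. -/
noncomputable def coulReal (p q : Space N → ℝ) : ℝ :=
  ∫ z : Space N × Space N, p z.1 * q z.2 * newton (z.1 - z.2)

lemma bddSupp_of_continuous {p : Space N → ℝ} (hp : Continuous p) (hs : HasCompactSupport p) :
    BddSupp p := by
  obtain ⟨R, hR⟩ := hs.isCompact.isBounded.subset_ball 0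
  obtain ⟨C, hC⟩ := hp.bounded_above_of_compact_support hs
  refine ⟨hp.measurable, C, R, (norm_nonneg _).trans (hC 0), fun x => ?_⟩
  by_cases hx : x ∈ Metric.ball 0 R
  · simpa [hx] using hC x
  · have : p x = 0 := by
      by_contra h
      exact hx (hR (subset_tsupport _ h))
    simp [hx, this]

lemma BddSupp.common {p q : Space N → ℝ} (hp : BddSupp p) (hq : BddSupp q) :
    ∃ C R : ℝ, 0 ≤ C ∧ (∀ x, |p x| ≤ (Metric.ball 0 R).indicator (fun _ => C) x) ∧
      ∀ x, |q x| ≤ (Metric.ball 0 R).indicator (fun _ => C) x := by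
  obtain ⟨-, C, R, hC, h⟩ := hp
  obtain ⟨-, C', R', hC', h'⟩ := hq
  refine ⟨max C C', max R R', hC.trans (le_max_left _ _), fun x => (h x).trans ?_,
    fun x => (h' x).trans ?_⟩
  · refine (indicator_le_indicator_of_subset (Metric.ball_subset_ball (le_max_left R R'))
      (fun _ => hC) x).trans (indicator_le_indicator (le_max_left _ _))
  · refine (indicator_le_indicator_of_subset (Metric.ball_subset_ball (le_max_right R R'))
      (fun _ => hC') x).trans (indicator_le_indicator (le_max_right _ _))

lemma ofReal_le_indicator {p : ℝ} {C R : ℝ} {x : Space N}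
    (h : p ≤ (Metric.ball 0 R).indicator (fun _ => C) x) :
    ENNReal.ofReal p ≤ (Metric.ball 0 R).indicator (fun _ => ENNReal.ofReal C) x := by
  by_cases hx : x ∈ Metric.ball 0 R
  · simp only [hx, indicator_of_mem] at h ⊢
    exact ENNReal.ofReal_le_ofReal h
  · simp only [hx, not_false_eq_true, indicator_of_notMem] at h ⊢
    simp [h]

lemma BddSupp.integrable_coul (hN : 3 ≤ N) {p q : Space N → ℝ} (hp : BddSupp p)
    (hq : BddSupp q) :
    Integrable fun z : Space N × Space N => p z.1 * q z.2 * newton (z.1 - z.2) := by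
  obtain ⟨C, R, hC, h, h'⟩ := hp.common hq
  have hpm := hp.1
  have hqm := hq.1
  refine ⟨by fun_prop, ?_⟩
  rw [HasFiniteIntegral, Measure.volume_eq_prod,
    lintegral_prod _ (by fun_prop)]
  set F : Space N → ℝ≥0∞ := (Metric.ball (0 : Space N) R).indicator (fun _ => ENNReal.ofReal C)
  have h1 : coul F F < ⊤ := coul_lt_top hN ENNReal.ofReal_ne_top (fun x => le_rfl)
  refine lt_of_le_of_lt ?_ h1
  unfold coul
  refine lintegral_mono fun x => lintegral_mono fun y => ?_
  dsimp only
  rw [enorm_mul, enorm_mul, Real.enorm_of_nonneg (newton_nonneg _)]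
  gcongr
  · rw [← Real.enorm_abs, Real.enorm_of_nonneg (abs_nonneg _)]
    exact ofReal_le_indicator (h x)
  · rw [← Real.enorm_abs, Real.enorm_of_nonneg (abs_nonneg _)]
    exact ofReal_le_indicator (h' y)

lemma coulReal_eq_toReal {p q : Space N → ℝ} (hp : Measurable p) (hq : Measurable q)
    (hp0 : ∀ x, 0 ≤ p x) (hq0 : ∀ x, 0 ≤ q x) :
    coulReal p q = (coul (fun x => ENNReal.ofReal (p x)) fun x => ENNReal.ofReal (q x)).toReal := by
  rw [coulReal, integral_eq_lintegral_of_nonneg_ae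
    (Eventually.of_forall fun z => mul_nonneg (mul_nonneg (hp0 _) (hq0 _)) (newton_nonneg _))
    (by fun_prop), Measure.volume_eq_prod, lintegral_prod _ (by fun_prop), coul]
  congr 1
  refine lintegral_congr fun x => lintegral_congr fun y => ?_
  rw [ENNReal.ofReal_mul (mul_nonneg (hp0 _) (hq0 _)), ENNReal.ofReal_mul (hp0 _)]

lemma BddSupp.sub_smul {p q : Space N → ℝ} (hp : BddSupp p) (hq : BddSupp q) (c : ℝ) :
    BddSupp fun x => c * p x - q x := by
  obtain ⟨C, R, hC, h, h'⟩ := hp.common hq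
  have hpm := hp.1
  have hqm := hq.1
  refine ⟨by fun_prop, |c| * C + C, R, by positivity, fun x => ?_⟩
  specialize h x
  specialize h' x
  by_cases hx : x ∈ Metric.ball 0 R
  · simp only [hx, indicator_of_mem] at h h' ⊢
    refine (abs_sub _ _).trans ?_
    rw [abs_mul]
    gcongr
  · simp only [hx, not_false_eq_true, indicator_of_notMem, abs_nonpos_iff] at h h' ⊢
    simp [h, h']

lemma BddSupp.of_abs_le {p q : Space N → ℝ} (hq : BddSupp q) (hp : Measurable p)
    (h : ∀ x, |p x| ≤ |q x|) : BddSupp p := by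
  obtain ⟨-, C, R, hC, h'⟩ := hq
  exact ⟨hp, C, R, hC, fun x => (h x).trans (h' x)⟩

lemma BddSupp.coul_lt_top (hN : 3 ≤ N) {p : Space N → ℝ} (hp : BddSupp p) :
    coul (fun x => ENNReal.ofReal (p x)) (fun x => ENNReal.ofReal (p x)) < ⊤ := by
  obtain ⟨-, C, R, hC, h⟩ := hp
  exact SchrodingerPoisson.coul_lt_top hN (C := ENNReal.ofReal C) (R := R) ENNReal.ofReal_ne_top
    fun x => ofReal_le_indicator ((le_abs_self _).trans (h x))

lemma two_mul_coulReal_le (hN : 3 ≤ N) {p q : Space N → ℝ} (hp : BddSupp p) (hq : BddSupp q)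
    (hp0 : ∀ x, 0 ≤ p x) (hq0 : ∀ x, 0 ≤ q x) :
    2 * coulReal p q ≤ coulReal p p + coulReal q q := by
  have hpm := hp.1
  have hqm := hq.1
  rw [coulReal_eq_toReal hpm hqm hp0 hq0, coulReal_eq_toReal hpm hpm hp0 hp0,
    coulReal_eq_toReal hqm hqm hq0 hq0,
    ← ENNReal.toReal_add (hp.coul_lt_top hN).ne (hq.coul_lt_top hN).ne]
  have h := two_mul_coul_le hN hpm.ennreal_ofReal hqm.ennreal_ofReal
  have h2 := ENNReal.toReal_mono
    (ENNReal.add_ne_top.2 ⟨(hp.coul_lt_top hN).ne, (hq.coul_lt_top hN).ne⟩) h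
  simpa using h2

lemma integral_quadratic {α : Type*} [MeasurableSpace α] {μ : Measure α} {A B C D : α → ℝ}
    (hA : Integrable A μ) (hB : Integrable B μ) (hC : Integrable C μ) (hD : Integrable D μ)
    (c : ℝ) : ∫ a, (c ^ 2 * A a - c * B a - c * C a + D a) ∂μ =
      c ^ 2 * ∫ a, A a ∂μ - c * ∫ a, B a ∂μ - c * ∫ a, C a ∂μ + ∫ a, D a ∂μ := by
  have h1 : Integrable (fun a => c ^ 2 * A a - c * B a) μ := (hA.const_mul _).sub (hB.const_mul _)
  have h2 : Integrable (fun a => c ^ 2 * A a - c * B a - c * C a) μ := h1.sub (hC.const_mul _)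
  rw [integral_add h2 hD, integral_sub h1 (hC.const_mul _),
    integral_sub (hA.const_mul _) (hB.const_mul _)]
  simp only [integral_const_mul]

lemma coulReal_sub_self (hN : 3 ≤ N) {p q : Space N → ℝ} (hp : BddSupp p) (hq : BddSupp q)
    (c : ℝ) : coulReal (fun x => c * p x - q x) (fun x => c * p x - q x) =
      c ^ 2 * coulReal p p - c * coulReal p q - c * coulReal q p + coulReal q q := by
  unfold coulReal
  rw [← integral_quadratic (hp.integrable_coul hN hp) (hp.integrable_coul hN hq)
    (hq.integrable_coul hN hp) (hq.integrable_coul hN hq)]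
  congr 1 with z
  ring

/-- Expanding `p = p⁺ - p⁻`, the mixed terms are controlled by the inequality for nonnegative
densities. Bounded support keeps every term finite, so that the subtraction is legitimate. -/
lemma coulReal_self_nonneg (hN : 3 ≤ N) {p : Space N → ℝ} (hp : BddSupp p) :
    0 ≤ coulReal p p := by
  have hpm := hp.1
  have ha : BddSupp fun x => max (p x) 0 := hp.of_abs_le (by fun_prop) fun x => by
    rw [abs_of_nonneg (le_max_right _ _)]; exact max_le (le_abs_self _) (abs_nonneg _)
  have hb : BddSupp fun x => max (-p x) 0 := hp.of_abs_le (by fun_prop) fun x => by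
    rw [abs_of_nonneg (le_max_right _ _)]; exact max_le (neg_le_abs _) (abs_nonneg _)
  have h1 := two_mul_coulReal_le hN ha hb (fun x => le_max_right _ _) fun x => le_max_right _ _
  have h2 := two_mul_coulReal_le hN hb ha (fun x => le_max_right _ _) fun x => le_max_right _ _
  have h3 := coulReal_sub_self hN ha hb 1
  have hx : (fun x => 1 * max (p x) 0 - max (-p x) 0) = p := by
    funext x
    rcases le_total (p x) 0 with h | h
    · rw [max_eq_right h, max_eq_left (by linarith)]; ring
    · rw [max_eq_left h, max_eq_right (by linarith)]; ring
  rw [hx] at h3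
  linarith

lemma coulReal_comm (p q : Space N → ℝ) : coulReal p q = coulReal q p := by
  unfold coulReal
  rw [Measure.volume_eq_prod, ← integral_prod_swap]
  congr 1 with z
  simp only [Prod.fst_swap, Prod.snd_swap]
  rw [← newton_neg, neg_sub]
  ring

lemma norm_fderiv_sq {g : Space N → ℝ} (x : Space N) :
    ‖fderiv ℝ g x‖ ^ 2 = ∑ i, fderiv ℝ g x (basisVec i) ^ 2 := by
  rw [← LinearIsometryEquiv.norm_map (InnerProductSpace.toDual ℝ (Space N)).symm,
    EuclideanSpace.norm_sq_eq]
  refine Finset.sum_congr rfl fun i _ => ?_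
  have := InnerProductSpace.toDual_symm_apply (𝕜 := ℝ) (x := basisVec i) (y := fderiv ℝ g x)
  rw [← this, EuclideanSpace.inner_single_right]
  simp

lemma integral_laplacian_mul_self {g : Space N → ℝ} (hg : ContDiff ℝ 2 g)
    (hgs : HasCompactSupport g) : ∫ x, g x * Δ g x = - ∫ x, ‖fderiv ℝ g x‖ ^ 2 := by
  have hc : ∀ i : Fin N, ContDiff ℝ 1 (fun y => fderiv ℝ g y (basisVec i)) := fun i =>
    (hg.fderiv_right (m := 1) (by norm_num)).clm_apply contDiff_const
  have hcs : ∀ i : Fin N, HasCompactSupport (fun y => fderiv ℝ g y (basisVec i)) := fun i =>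
    hasCompactSupport_fderiv_apply hgs _
  have hdi : ∀ i : Fin N, Continuous fun x =>
      fderiv ℝ (fun y => fderiv ℝ g y (basisVec i)) x (basisVec i) := fun i =>
    ((hc i).continuous_fderiv (by norm_num)).clm_apply continuous_const
  have hi1 : ∀ i : Fin N, Integrable fun x => g x *
      fderiv ℝ (fun y => fderiv ℝ g y (basisVec i)) x (basisVec i) := fun i =>
    (hg.continuous.mul (hdi i)).integrable_of_hasCompactSupport hgs.mul_right
  have hi2 : ∀ i : Fin N, Integrable fun x => fderiv ℝ g x (basisVec i) *
      fderiv ℝ g x (basisVec i) := fun i =>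
    ((hc i).continuous.mul (hc i).continuous).integrable_of_hasCompactSupport (hcs i).mul_right
  simp_rw [laplacian_eq_sum hg, norm_fderiv_sq, Finset.mul_sum, sq]
  rw [integral_finsetSum _ fun i _ => hi1 i, integral_finsetSum _ fun i _ => hi2 i,
    ← Finset.sum_neg_distrib]
  refine Finset.sum_congr rfl fun i _ => ?_
  rw [integral_mul_fderiv_eq_neg_fderiv_mul_of_integrable (hi2 i) (hi1 i)]
  · exact (hg.continuous.mul (hc i).continuous).integrable_of_hasCompactSupport hgs.mul_right
  · exact fun x _ => (hg.differentiable (by norm_num)) x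
  · exact fun x _ => ((hc i).differentiable (by norm_num)) x

/-- Fubini's theorem and the fundamental solution. Taking `p = Δg` turns the Coulomb energy of `Δg`
into `ω` times the Dirichlet integral of `g`. -/
lemma coulReal_laplacian (hN : 3 ≤ N) {p g : Space N → ℝ} (hp : BddSupp p) (hg : ContDiff ℝ 2 g)
    (hgs : HasCompactSupport g) : coulReal p (Δ g) = - omega N * ∫ x, p x * g x := by
  have hL := bddSupp_of_continuous (continuous_laplacian hg) (hasCompactSupport_laplacian hg hgs)
  have hi := hp.integrable_coul hN hL
  rw [Measure.volume_eq_prod] at hi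
  rw [coulReal, Measure.volume_eq_prod, integral_prod _ hi, ← integral_const_mul]
  congr 1 with x
  have : ∀ y, p x * Δ g y * newton (x - y) = p x * (newton (x - y) * Δ g y) := fun y => by ring
  simp_rw [this]
  rw [integral_const_mul, integral_newton_mul_laplacian hN hg hgs]
  ring

lemma omega_pos (hN : 3 ≤ N) : 0 < omega N := by
  have := nontrivial_space hN
  have h3 : (3 : ℝ) ≤ N := by exact_mod_cast hN
  refine mul_pos (by linarith) ?_
  rw [measureReal_def]
  refine ENNReal.toReal_pos ?_ (measure_ne_top _ _)
  rw [Measure.measure_univ_ne_zero]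
  exact Measure.toSphere_ne_zero _

/-- The dual form of the energy estimate for the Newtonian potential of a bounded density. -/
theorem two_mul_integral_mul_le (hN : 3 ≤ N) {f g : Space N → ℝ} (hf : BddSupp f)
    (hg : ContDiff ℝ 2 g) (hgs : HasCompactSupport g) (c : ℝ) :
    2 * c * ∫ x, f x * g x ≤ (∫ x, ‖fderiv ℝ g x‖ ^ 2) + c ^ 2 * (coulReal f f / omega N) := by
  have hL := bddSupp_of_continuous (continuous_laplacian hg) (hasCompactSupport_laplacian hg hgs)
  have hω := omega_pos hN
  -- The energy of `-c f - Δg` expands to `c² D(f) - 2cω ∫ f g + ω ∫ |∇g|²`.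
  have h0 := coulReal_self_nonneg hN (hf.sub_smul hL (-c))
  rw [coulReal_sub_self hN hf hL, coulReal_comm (Δ g) f, coulReal_laplacian hN hf hg hgs,
    coulReal_laplacian hN hL hg hgs] at h0
  have h2 : ∫ x, Δ g x * g x = - ∫ x, ‖fderiv ℝ g x‖ ^ 2 := by
    rw [← integral_laplacian_mul_self hg hgs]
    simp_rw [mul_comm]
  rw [h2] at h0
  have h3 : c ^ 2 * (coulReal f f / omega N) = c ^ 2 * coulReal f f / omega N := by ring
  rw [h3, ← sub_le_iff_le_add', le_div_iff₀ hω]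
  nlinarith

/-! ### Mollification -/

/-- A sequence of bump functions that shrink to the origin. -/
noncomputable def bump (N : ℕ) (k : ℕ) : ContDiffBump (0 : Space N) where
  rIn := 1 / ((k : ℝ) + 1)
  rOut := 2 * (1 / ((k : ℝ) + 1))
  rIn_pos := by positivity
  rIn_lt_rOut := by
    have : 0 < 1 / ((k : ℝ) + 1) := by positivity
    linarith

/-- Mollification at scale `1 / (k + 1)`. -/
noncomputable def moll {F : Type*} [NormedAddCommGroup F] [NormedSpace ℝ F] (k : ℕ)
    (h : Space N → F) : Space N → F :=
  convolution ((bump N k).normed volume) h (ContinuousLinearMap.lsmul ℝ ℝ) volume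

section

variable {F : Type*} [NormedAddCommGroup F] [NormedSpace ℝ F]

lemma moll_apply (k : ℕ) (h : Space N → F) (x : Space N) :
    moll k h x = ∫ t, (bump N k).normed volume (x - t) • h t :=
  convolution_lsmul_swap

lemma contDiff_moll (k : ℕ) {h : Space N → F} (hh : LocallyIntegrable h volume) {n : ℕ∞} :
    ContDiff ℝ n (moll k h) :=
  (bump N k).hasCompactSupport_normed.contDiff_convolution_left _ (bump N k).contDiff_normed hh

lemma continuous_moll (k : ℕ) {h : Space N → F} (hh : LocallyIntegrable h volume) :
    Continuous (moll k h) :=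
  (contDiff_moll k hh (n := 0)).continuous

lemma ae_tendsto_moll [CompleteSpace F] {h : Space N → F} (hh : LocallyIntegrable h volume) :
    ∀ᵐ x, Tendsto (fun k => moll k h x) atTop (𝓝 (h x)) := by
  -- The value `K = 2` is the fixed ratio of outer to inner radius of the bumps.
  refine ContDiffBump.ae_convolution_tendsto_right_of_locallyIntegrable (K := 2) ?_ ?_ hh
  · have := (tendsto_one_div_add_atTop_nhds_zero_nat (𝕜 := ℝ)).const_mul 2
    simpa [bump] using this
  · exact Eventually.of_forall fun k => le_rfl

/-- Cauchy–Schwarz for the splitting `w h = w^(1/2) · (w^(1/2) h)`. -/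
lemma sq_lintegral_mul_le {α : Type*} [MeasurableSpace α] {μ : Measure α} {w h : α → ℝ≥0∞}
    (hw : Measurable w) (hh : AEMeasurable h μ) (h1 : ∫⁻ a, w a ∂μ ≤ 1) :
    (∫⁻ a, w a * h a ∂μ) ^ 2 ≤ ∫⁻ a, w a * h a ^ 2 ∂μ := by
  have key := ENNReal.lintegral_mul_le_Lp_mul_Lq μ Real.HolderConjugate.two_two
    (f := fun a => w a ^ (1 / 2 : ℝ)) (g := fun a => w a ^ (1 / 2 : ℝ) * h a)
    (by fun_prop) (by fun_prop)
  have e1 : ∀ a, w a ^ (1 / 2 : ℝ) * w a ^ (1 / 2 : ℝ) = w a := fun a => by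
    rw [← ENNReal.rpow_add_of_nonneg _ _ (by norm_num) (by norm_num)]; norm_num
  have e2 : ∀ a, (w a ^ (1 / 2 : ℝ)) ^ (2 : ℝ) = w a := fun a => by
    rw [← ENNReal.rpow_mul]; norm_num
  simp only [Pi.mul_apply, ← mul_assoc, e1, ENNReal.mul_rpow_of_nonneg _ _ zero_le_two, e2] at key
  have key2 : (∫⁻ a, w a * h a ∂μ) ≤ (∫⁻ a, w a * h a ^ 2 ∂μ) ^ (1 / 2 : ℝ) := by
    refine key.trans ?_
    calc _ ≤ (1 : ℝ≥0∞) ^ (1 / 2 : ℝ) * (∫⁻ a, w a * h a ^ (2 : ℝ) ∂μ) ^ (1 / 2 : ℝ) := by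
          gcongr
      _ = _ := by simp
  calc (∫⁻ a, w a * h a ∂μ) ^ 2 ≤ ((∫⁻ a, w a * h a ^ 2 ∂μ) ^ (1 / 2 : ℝ)) ^ 2 := by gcongr
    _ = _ := by
      rw [← ENNReal.rpow_natCast, ← ENNReal.rpow_mul]; norm_num

lemma lintegral_bump (k : ℕ) :
    ∫⁻ t, ENNReal.ofReal ((bump N k).normed volume t) = 1 := by
  rw [← ofReal_integral_eq_lintegral_ofReal (bump N k).integrable_normed
    (Eventually.of_forall fun x => (bump N k).nonneg_normed x), (bump N k).integral_normed]
  simp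

/-- Jensen's inequality against a kernel of mass one, followed by Tonelli. The constant `1` matters:
`∫ |∇u|²` must later cancel exactly between the two main inequalities. -/
lemma lintegral_moll_sq_le (k : ℕ) {h : Space N → F} (hh : AEStronglyMeasurable h volume) :
    ∫⁻ x, ‖moll k h x‖ₑ ^ 2 ≤ ∫⁻ x, ‖h x‖ₑ ^ 2 := by
  set w : Space N → ℝ≥0∞ := fun t => ENNReal.ofReal ((bump N k).normed volume t) with hw
  have hwm : Measurable w := (bump N k).continuous_normed.measurable.ennreal_ofReal
  have hhm : AEMeasurable (fun t => ‖h t‖ₑ) volume := hh.enorm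
  have h1 : ∀ x, ‖moll k h x‖ₑ ^ 2 ≤ ∫⁻ t, w (x - t) * ‖h t‖ₑ ^ 2 := by
    intro x
    refine le_trans ?_ (sq_lintegral_mul_le (w := fun t => w (x - t)) (by fun_prop) hhm ?_)
    · gcongr
      rw [moll_apply]
      refine (enorm_integral_le_lintegral_enorm _).trans (lintegral_mono fun t => ?_)
      dsimp only
      rw [enorm_smul, Real.enorm_of_nonneg ((bump N k).nonneg_normed _)]
    · rw [lintegral_sub_left_eq_self w x, lintegral_bump]
  refine (lintegral_mono h1).trans ?_
  rw [lintegral_lintegral_swap]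
  · refine lintegral_mono fun t => ?_
    dsimp only
    rw [lintegral_mul_const _ (by fun_prop), lintegral_sub_right_eq_self w t, lintegral_bump,
      one_mul]
  · have h2 : AEMeasurable (fun p : Space N × Space N => ‖h p.2‖ₑ ^ 2)
        (volume.prod volume) := (hhm.comp_snd (f := fun t => ‖h t‖ₑ)).pow_const 2
    exact (AEMeasurable.mul (by fun_prop) h2)

lemma integrable_moll_sq (k : ℕ) {h : Space N → F} (hh : LocallyIntegrable h volume)
    (h2 : Integrable fun x => ‖h x‖ ^ 2) :
    (Integrable fun x => ‖moll k h x‖ ^ 2) ∧ ∫ x, ‖moll k h x‖ ^ 2 ≤ ∫ x, ‖h x‖ ^ 2 := by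
  have e : ∀ f : Space N → F, ∀ x, ENNReal.ofReal (‖f x‖ ^ 2) = ‖f x‖ₑ ^ 2 := fun f x => by
    rw [ENNReal.ofReal_pow (norm_nonneg _), ofReal_norm]
  have hle := lintegral_moll_sq_le k hh.aestronglyMeasurable
  have hfin : ∫⁻ x, ‖h x‖ₑ ^ 2 < ⊤ := by
    simpa only [e] using h2.lintegral_lt_top
  have hi : Integrable fun x => ‖moll k h x‖ ^ 2 := by
    refine ⟨((continuous_moll k hh).norm.pow 2).aestronglyMeasurable, ?_⟩
    rw [hasFiniteIntegral_iff_ofReal (Eventually.of_forall fun x => by positivity)]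
    simp only [e]
    exact hle.trans_lt hfin
  refine ⟨hi, ?_⟩
  rw [integral_eq_lintegral_of_nonneg_ae (Eventually.of_forall fun x => by positivity) hi.1,
    integral_eq_lintegral_of_nonneg_ae (Eventually.of_forall fun x => by positivity) h2.1]
  simp only [e]
  exact ENNReal.toReal_mono hfin.ne hle

end

/-- A test function from a smooth compactly supported function. -/
noncomputable def toTestFn (g : Space N → ℝ) (hg : ContDiff ℝ (⊤ : ℕ∞) g)
    (hs : HasCompactSupport g) : TestFn N :=
  ⟨g, hg, hs, by simp⟩

@[simp] lemma coe_toTestFn (g : Space N → ℝ) (hg : ContDiff ℝ (⊤ : ℕ∞) g)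
    (hs : HasCompactSupport g) : (toTestFn g hg hs : Space N → ℝ) = g := rfl

lemma HasWeakGradient.integral_mul_fderiv {u : Space N → ℝ} {G : Space N → Space N}
    (h : HasWeakGradient u G) {g : Space N → ℝ} (hg : ContDiff ℝ (⊤ : ℕ∞) g)
    (hs : HasCompactSupport g) (i : Fin N) :
    ∫ x, u x * fderiv ℝ g x (basisVec i) = - ∫ x, G x i * g x :=
  h.integral_eq (toTestFn g hg hs) i

lemma locallyIntegrable_coord {G : Space N → Space N} (h : LocallyIntegrable G volume)
    (i : Fin N) : LocallyIntegrable (fun x => G x i) volume := by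
  intro x
  obtain ⟨s, hs, hi⟩ := h x
  exact ⟨s, hs, (EuclideanSpace.proj (𝕜 := ℝ) i).integrable_comp hi⟩

lemma integrable_mul_of_locallyIntegrable {u g : Space N → ℝ} (h : LocallyIntegrable u volume)
    (hg : Continuous g) (hs : HasCompactSupport g) : Integrable fun x => u x * g x := by
  simpa only [smul_eq_mul, mul_comm] using h.integrable_smul_left_of_hasCompactSupport hg hs

/-- The derivative falls on the mollifier, and `t ↦ φ(x - t)` is an admissible test function for the
weak gradient. The sign from reflecting the variable cancels the one from integration by parts. -/
lemma HasWeakGradient.fderiv_moll {u : Space N → ℝ} {G : Space N → Space N}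
    (h : HasWeakGradient u G) (k : ℕ) (x : Space N) :
    fderiv ℝ (moll k u) x = innerSL ℝ (moll k G x) := by
  set φ := (bump N k).normed (volume : Measure (Space N)) with hφ
  have hφc : ContDiff ℝ (⊤ : ℕ∞) φ := (bump N k).contDiff_normed
  have hφs : HasCompactSupport φ := (bump N k).hasCompactSupport_normed
  have hφ1 : ContDiff ℝ 1 φ := (bump N k).contDiff_normed (n := 1)
  have hd := hφs.hasFDerivAt_convolution_left (ContinuousLinearMap.lsmul ℝ ℝ)
    hφ1 h.locallyIntegrable x
  have hψc : ContDiff ℝ (⊤ : ℕ∞) fun t => φ (x - t) := by fun_prop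
  have hψs : HasCompactSupport fun t => φ (x - t) :=
    hφs.comp_homeomorph (Homeomorph.subLeft x)
  have hint : ∀ v, fderiv ℝ (moll k u) x v = ∫ t, fderiv ℝ φ (x - t) v * u t := by
    intro v
    unfold moll
    rw [hd.fderiv, convolution_eq_swap]
    have hi : Integrable fun t => ((ContinuousLinearMap.lsmul ℝ ℝ).precompL (Space N)
        (fderiv ℝ φ (x - t))) (u t) := by
      have := (hφs.fderiv (𝕜 := ℝ)).convolutionExists_left
        ((ContinuousLinearMap.lsmul ℝ ℝ).precompL (Space N))
        (hφ1.continuous_fderiv (by norm_num)) h.locallyIntegrable x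
      exact this.integrable_swap
    rw [ContinuousLinearMap.integral_apply hi]
    rfl
  have hderiv : ∀ t v, fderiv ℝ (fun t => φ (x - t)) t v = - fderiv ℝ φ (x - t) v := by
    intro t v
    have h1 : HasFDerivAt (fun t : Space N => x - t) (-ContinuousLinearMap.id ℝ (Space N)) t :=
      (hasFDerivAt_id t).const_sub x
    have h2 := ((hφ1.differentiable (by norm_num)) (x - t)).hasFDerivAt.comp t h1
    have h3 : fderiv ℝ (fun t => φ (x - t)) t = _ := h2.fderiv
    rw [h3]
    simp
  have hbasis : ∀ i, fderiv ℝ (moll k u) x (basisVec i) = moll k G x i := by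
    intro i
    rw [hint]
    have h1 := h.integral_mul_fderiv hψc hψs i
    simp_rw [hderiv] at h1
    have h2 : ∫ t, u t * -fderiv ℝ φ (x - t) (basisVec i) =
        - ∫ t, fderiv ℝ φ (x - t) (basisVec i) * u t := by
      rw [← integral_neg]
      congr 1 with t
      ring
    rw [h2, neg_inj] at h1
    rw [h1, moll_apply]
    have hi : Integrable fun t => φ (x - t) • G t :=
      h.locallyIntegrable_grad.integrable_smul_left_of_hasCompactSupport hψc.continuous hψs
    have h3 := (EuclideanSpace.proj (𝕜 := ℝ) i).integral_comp_comm hi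
    simp only [PiLp.proj_apply] at h3
    rw [← h3]
    congr 1 with t
    simp [mul_comm]
  ext v
  rw [clm_apply_eq_sum, clm_apply_eq_sum (innerSL ℝ (moll k G x))]
  refine Finset.sum_congr rfl fun i _ => ?_
  rw [hbasis]
  simp [EuclideanSpace.inner_single_right]

/-! ### Cutoff functions -/

/-- The cutoff function, equal to `1` on the ball of radius `n + 1`. -/
noncomputable def cutoff (N : ℕ) (n : ℕ) (x : Space N) : ℝ :=
  bump N 0 ((1 / ((n : ℝ) + 1)) • x)

lemma contDiff_cutoff (n : ℕ) {m : ℕ∞} : ContDiff ℝ m (cutoff N n) := by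
  unfold cutoff
  exact (bump N 0).contDiff.comp (by fun_prop)

lemma hasCompactSupport_cutoff (n : ℕ) : HasCompactSupport (cutoff N n) := by
  have h : (1 / ((n : ℝ) + 1)) ≠ 0 := by positivity
  exact (bump N 0).hasCompactSupport.comp_homeomorph (Homeomorph.smulOfNeZero _ h)

lemma cutoff_nonneg (n : ℕ) (x : Space N) : 0 ≤ cutoff N n x := (bump N 0).nonneg

lemma cutoff_le_one (n : ℕ) (x : Space N) : cutoff N n x ≤ 1 := (bump N 0).le_one

lemma tendsto_cutoff (x : Space N) : Tendsto (fun n => cutoff N n x) atTop (𝓝 1) := by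
  refine tendsto_const_nhds.congr' ?_
  filter_upwards [eventually_ge_atTop ⌈‖x‖⌉₊] with n hn
  symm
  refine (bump N 0).one_of_mem_closedBall ?_
  have h1 : ‖x‖ ≤ n := (Nat.le_ceil _).trans (by exact_mod_cast hn)
  simp only [bump, mem_closedBall_zero_iff, norm_smul]
  rw [Real.norm_of_nonneg (by positivity), one_div, inv_mul_le_iff₀ (by positivity)]
  simp
  linarith

lemma exists_norm_fderiv_cutoff_le (N : ℕ) :
    ∃ C : ℝ, 0 ≤ C ∧ ∀ n x, ‖fderiv ℝ (cutoff N n) x‖ ≤ C * (1 / ((n : ℝ) + 1)) := by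
  have hc : ContDiff ℝ 1 (bump N 0) := (bump N 0).contDiff
  obtain ⟨C, hC⟩ := (hc.continuous_fderiv (by norm_num)).bounded_above_of_compact_support
    ((bump N 0).hasCompactSupport.fderiv (𝕜 := ℝ))
  refine ⟨C, (norm_nonneg _).trans (hC 0), fun n x => ?_⟩
  have h1 : fderiv ℝ (cutoff N n) x =
      (1 / ((n : ℝ) + 1)) • fderiv ℝ (bump N 0) ((1 / ((n : ℝ) + 1)) • x) := by
    unfold cutoff
    exact fderiv_comp_smul _
  rw [h1, norm_smul, Real.norm_of_nonneg (by positivity), mul_comm]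
  gcongr
  exact hC _

/-! ### The estimate of `∫ ρ |u|³` by the energy -/

/-- Fatou's lemma for Bochner integrals of nonnegative functions with convergent bounds. -/
lemma integral_le_of_tendsto_ae {α : Type*} [MeasurableSpace α] {μ : Measure α} {F : ℕ → α → ℝ}
    {f : α → ℝ} {b : ℕ → ℝ} {B : ℝ} (hF : ∀ n, Integrable (F n) μ)
    (h0 : ∀ n, ∀ᵐ x ∂μ, 0 ≤ F n x)
    (hlim : ∀ᵐ x ∂μ, Tendsto (fun n => F n x) atTop (𝓝 (f x)))
    (hb : ∀ n, ∫ x, F n x ∂μ ≤ b n) (hB : Tendsto b atTop (𝓝 B)) :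
    Integrable f μ ∧ ∫ x, f x ∂μ ≤ B := by
  have hfm : AEStronglyMeasurable f μ := aestronglyMeasurable_of_tendsto_ae atTop
    (fun n => (hF n).1) hlim
  have h0' : ∀ᵐ x ∂μ, ∀ n, 0 ≤ F n x := ae_all_iff.2 h0
  have hf0 : 0 ≤ᵐ[μ] f := by
    filter_upwards [h0', hlim] with x hx hl
    exact ge_of_tendsto' hl hx
  have hB0 : 0 ≤ B := ge_of_tendsto' hB fun n => (integral_nonneg_of_ae (h0 n)).trans (hb n)
  have key : ∫⁻ x, ENNReal.ofReal (f x) ∂μ ≤ ENNReal.ofReal B := by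
    calc ∫⁻ x, ENNReal.ofReal (f x) ∂μ
        = ∫⁻ x, liminf (fun n => ENNReal.ofReal (F n x)) atTop ∂μ := by
          refine lintegral_congr_ae ?_
          filter_upwards [hlim] with x hx
          exact ((ENNReal.continuous_ofReal.tendsto _).comp hx).liminf_eq.symm
      _ ≤ liminf (fun n => ∫⁻ x, ENNReal.ofReal (F n x) ∂μ) atTop :=
          lintegral_liminf_le' fun n => (hF n).1.aemeasurable.ennreal_ofReal
      _ ≤ liminf (fun n => ENNReal.ofReal (b n)) atTop := by
          refine liminf_le_liminf (Eventually.of_forall fun n => ?_)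
          rw [← ofReal_integral_eq_lintegral_ofReal (hF n) (h0 n)]
          exact ENNReal.ofReal_le_ofReal (hb n)
      _ = ENNReal.ofReal B := ((ENNReal.continuous_ofReal.tendsto _).comp hB).liminf_eq
  refine ⟨⟨hfm, ?_⟩, ?_⟩
  · rw [hasFiniteIntegral_iff_ofReal hf0]
    exact key.trans_lt ENNReal.ofReal_lt_top
  · rw [integral_eq_lintegral_of_nonneg_ae hf0 hfm]
    exact ENNReal.toReal_le_of_le_ofReal hB0 key

/-- A smooth approximation of the absolute value. -/
noncomputable def smoothAbs (δ s : ℝ) : ℝ := √(s ^ 2 + δ ^ 2) - δ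

lemma smoothAbs_nonneg {δ : ℝ} (s : ℝ) : 0 ≤ smoothAbs δ s := by
  unfold smoothAbs
  have : δ ≤ √(s ^ 2 + δ ^ 2) := Real.le_sqrt_of_sq_le (by nlinarith [sq_nonneg s])
  linarith

lemma hasDerivAt_smoothAbs {δ : ℝ} (hδ : 0 < δ) (s : ℝ) :
    HasDerivAt (smoothAbs δ) (s / √(s ^ 2 + δ ^ 2)) s := by
  have h1 : HasDerivAt (fun s : ℝ => s ^ 2 + δ ^ 2) (2 * s) s := by
    simpa using ((hasDerivAt_id s).pow 2).add_const (δ ^ 2)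
  have h2 := (h1.sqrt (by positivity)).sub_const δ
  refine h2.congr_deriv ?_
  field_simp

lemma contDiff_smoothAbs {δ : ℝ} (hδ : 0 < δ) {n : ℕ∞} : ContDiff ℝ n (smoothAbs δ) := by
  unfold smoothAbs
  exact ((by fun_prop : ContDiff ℝ n fun s : ℝ => s ^ 2 + δ ^ 2).sqrt
    fun s => by positivity).sub contDiff_const

lemma smoothAbs_zero {δ : ℝ} (hδ : 0 < δ) : smoothAbs δ 0 = 0 := by
  simp [smoothAbs, Real.sqrt_sq hδ.le]

/-- The derivative of `smoothAbs δ` has modulus at most `1`, so `|u|` can be approximated by smooth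
functions without increasing the Dirichlet integral. -/
lemma norm_fderiv_smoothAbs_comp_le {δ : ℝ} (hδ : 0 < δ) {ψ : Space N → ℝ} {x : Space N}
    (hψ : DifferentiableAt ℝ ψ x) :
    ‖fderiv ℝ (fun x => smoothAbs δ (ψ x)) x‖ ≤ ‖fderiv ℝ ψ x‖ := by
  have h1 := (hasDerivAt_smoothAbs hδ (ψ x)).comp_hasFDerivAt x hψ.hasFDerivAt
  have h2 : fderiv ℝ (fun x => smoothAbs δ (ψ x)) x = _ := h1.fderiv
  rw [h2, norm_smul]
  refine mul_le_of_le_one_left (norm_nonneg _) ?_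
  rw [norm_div, Real.norm_of_nonneg (Real.sqrt_nonneg _)]
  refine div_le_one_of_le₀ ?_ (Real.sqrt_nonneg _)
  exact Real.abs_le_sqrt (by nlinarith [sq_nonneg δ])

lemma integrable_norm_fderiv_sq {ψ : Space N → ℝ} (hψ : ContDiff ℝ 1 ψ)
    (hs : HasCompactSupport ψ) : Integrable fun x => ‖fderiv ℝ ψ x‖ ^ 2 := by
  have hc : Continuous fun x => ‖fderiv ℝ ψ x‖ ^ 2 :=
    (hψ.continuous_fderiv (by norm_num)).norm.pow 2
  refine hc.integrable_of_hasCompactSupport ?_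
  have h1 : HasCompactSupport fun x => ‖fderiv ℝ ψ x‖ := (hs.fderiv (𝕜 := ℝ)).norm
  exact h1.comp_left (g := fun r : ℝ => r ^ 2) (by norm_num)

lemma integral_norm_fderiv_smoothAbs_sq_le {δ : ℝ} (hδ : 0 < δ) {ψ : Space N → ℝ}
    (hψ : ContDiff ℝ 1 ψ) (hs : HasCompactSupport ψ) :
    ∫ x, ‖fderiv ℝ (fun x => smoothAbs δ (ψ x)) x‖ ^ 2 ≤ ∫ x, ‖fderiv ℝ ψ x‖ ^ 2 := by
  refine integral_mono_of_nonneg (Eventually.of_forall fun x => by positivity)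
    (integrable_norm_fderiv_sq hψ hs) (Eventually.of_forall fun x => ?_)
  exact pow_le_pow_left₀ (norm_nonneg _)
    (norm_fderiv_smoothAbs_comp_le hδ ((hψ.differentiable (by norm_num)) x)) 2

/-- Smooth compactly supported approximations of a Sobolev function. -/
noncomputable def approx (u : Space N → ℝ) (n : ℕ) (x : Space N) : ℝ :=
  cutoff N n x * moll n u x

/-- The product rule bounds the gradient by `a + s b`, and `2ab ≤ a² + b²` distributes the cross
term. As `s → 0` only `a²` is left, with coefficient `1`. -/
lemma norm_fderiv_approx_sq_le {u : Space N → ℝ} {G : Space N → Space N}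
    (h : HasWeakGradient u G) {s : ℝ} (n : ℕ) (x : Space N)
    (hs : ‖fderiv ℝ (cutoff N n) x‖ ≤ s) :
    ‖fderiv ℝ (approx u n) x‖ ^ 2 ≤
      (1 + s) * ‖moll n G x‖ ^ 2 + (s + s ^ 2) * ‖moll n u x‖ ^ 2 := by
  have hs0 : 0 ≤ s := (norm_nonneg _).trans hs
  have h1 : HasFDerivAt (cutoff N n) (fderiv ℝ (cutoff N n) x) x :=
    (((contDiff_cutoff n (m := 1)).differentiable (by norm_num)) x).hasFDerivAt
  have h2 : HasFDerivAt (moll n u) (fderiv ℝ (moll n u) x) x :=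
    (((contDiff_moll n h.locallyIntegrable (n := 1)).differentiable (by norm_num)) x).hasFDerivAt
  have h3 : fderiv ℝ (approx u n) x = _ := (h1.mul h2).fderiv
  have h4 : ‖fderiv ℝ (approx u n) x‖ ≤ ‖moll n G x‖ + s * ‖moll n u x‖ := by
    rw [h3, h.fderiv_moll]
    refine (norm_add_le _ _).trans (add_le_add ?_ ?_)
    · rw [norm_smul, innerSL_apply_norm, Real.norm_of_nonneg (cutoff_nonneg n x)]
      exact mul_le_of_le_one_left (norm_nonneg _) (cutoff_le_one n x)
    · rw [norm_smul, mul_comm]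
      gcongr
  calc ‖fderiv ℝ (approx u n) x‖ ^ 2 ≤ (‖moll n G x‖ + s * ‖moll n u x‖) ^ 2 := by gcongr
    _ ≤ _ := by nlinarith [mul_nonneg hs0 (sq_nonneg (‖moll n G x‖ - ‖moll n u x‖))]

lemma integral_fderiv_approx_sq_le {u : Space N → ℝ} {G : Space N → Space N}
    (h : HasWeakGradient u G) (hu2 : Integrable fun x => ‖u x‖ ^ 2)
    (hG2 : Integrable fun x => ‖G x‖ ^ 2) {s : ℝ} (n : ℕ)
    (hs : ∀ x, ‖fderiv ℝ (cutoff N n) x‖ ≤ s) :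
    ∫ x, ‖fderiv ℝ (approx u n) x‖ ^ 2 ≤
      (1 + s) * (∫ x, ‖G x‖ ^ 2) + (s + s ^ 2) * ∫ x, ‖u x‖ ^ 2 := by
  have hs0 : 0 ≤ s := (norm_nonneg _).trans (hs 0)
  obtain ⟨hGi, hGle⟩ := integrable_moll_sq n h.locallyIntegrable_grad hG2
  obtain ⟨hui, hule⟩ := integrable_moll_sq n h.locallyIntegrable hu2
  calc ∫ x, ‖fderiv ℝ (approx u n) x‖ ^ 2
      ≤ ∫ x, ((1 + s) * ‖moll n G x‖ ^ 2 + (s + s ^ 2) * ‖moll n u x‖ ^ 2) :=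
        integral_mono_of_nonneg (Eventually.of_forall fun x => by positivity)
          ((hGi.const_mul _).add (hui.const_mul _))
          (Eventually.of_forall fun x => norm_fderiv_approx_sq_le h n x (hs x))
    _ = (1 + s) * (∫ x, ‖moll n G x‖ ^ 2) + (s + s ^ 2) * ∫ x, ‖moll n u x‖ ^ 2 := by
        rw [integral_add (hGi.const_mul _) (hui.const_mul _), integral_const_mul,
          integral_const_mul]
    _ ≤ _ := by gcongr

/-- Bounded compactly supported truncations of a nonnegative density. -/
noncomputable def truncDensity (f : Space N → ℝ) (n : ℕ) : Space N → ℝ :=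
  (Metric.ball 0 n).indicator fun x => min (f x) n

lemma truncDensity_nonneg {f : Space N → ℝ} (h0 : ∀ x, 0 ≤ f x) (n : ℕ) (x : Space N) :
    0 ≤ truncDensity f n x :=
  indicator_nonneg (fun x _ => le_min (h0 x) (Nat.cast_nonneg n)) x

lemma truncDensity_le {f : Space N → ℝ} (h0 : ∀ x, 0 ≤ f x) (n : ℕ) (x : Space N) :
    truncDensity f n x ≤ f x :=
  (indicator_le_self' (fun x _ => le_min (h0 x) (Nat.cast_nonneg n)) x).trans (min_le_left _ _)

lemma bddSupp_truncDensity {f : Space N → ℝ} (hf : Measurable f) (h0 : ∀ x, 0 ≤ f x) (n : ℕ) :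
    BddSupp (truncDensity f n) := by
  refine ⟨(hf.min measurable_const).indicator measurableSet_ball, n, n, Nat.cast_nonneg n,
    fun x => ?_⟩
  rw [abs_of_nonneg (truncDensity_nonneg h0 n x)]
  exact indicator_le_indicator (min_le_right _ _)

lemma tendsto_truncDensity (f : Space N → ℝ) (x : Space N) :
    Tendsto (fun n => truncDensity f n x) atTop (𝓝 (f x)) := by
  refine tendsto_const_nhds.congr' ?_
  filter_upwards [eventually_gt_atTop ⌈‖x‖⌉₊, eventually_ge_atTop ⌈f x⌉₊] with n hn hn'
  have h1 : ‖x‖ < n := (Nat.le_ceil _).trans_lt (by exact_mod_cast hn)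
  have h2 : f x ≤ n := (Nat.le_ceil _).trans (by exact_mod_cast hn')
  rw [truncDensity, indicator_of_mem (by simpa using h1), min_eq_left h2]

/-- The estimate `2 c ∫ f |u| ≤ ∫ |∇u|² + c² D(f)` for densities of finite Coulomb energy. -/
theorem two_mul_integral_mul_abs_le (hN : 3 ≤ N) {u : Space N → ℝ} {G : Space N → Space N}
    (h : HasWeakGradient u G) (hu2 : Integrable fun x => ‖u x‖ ^ 2)
    (hG2 : Integrable fun x => ‖G x‖ ^ 2) {f : Space N → ℝ} (hf : Measurable f)
    (h0 : ∀ x, 0 ≤ f x)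
    (hfin : coul (fun x => ENNReal.ofReal (f x)) (fun x => ENNReal.ofReal (f x)) ≠ ⊤)
    {c : ℝ} (hc : 0 ≤ c) :
    (Integrable fun x => 2 * c * (f x * |u x|)) ∧
    ∫ x, 2 * c * (f x * |u x|) ≤ (∫ x, ‖G x‖ ^ 2) + c ^ 2 *
      ((coul (fun x => ENNReal.ofReal (f x)) fun x => ENNReal.ofReal (f x)).toReal / omega N) := by
  set D := (coul (fun x => ENNReal.ofReal (f x)) fun x => ENNReal.ofReal (f x)).toReal with hD
  obtain ⟨C, hC, hcut⟩ := exists_norm_fderiv_cutoff_le N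
  have hω := omega_pos hN
  set δ : ℕ → ℝ := fun n => 1 / ((n : ℝ) + 1) with hδ
  have hδpos : ∀ n, 0 < δ n := fun n => by simp only [hδ]; positivity
  have hδlim : Tendsto δ atTop (𝓝 0) := tendsto_one_div_add_atTop_nhds_zero_nat
  set g : ℕ → Space N → ℝ := fun n x => smoothAbs (δ n) (approx u n x) with hg
  have hac : ∀ n, ContDiff ℝ 2 (approx u n) := fun n =>
    (contDiff_cutoff n (m := 2)).mul (contDiff_moll n h.locallyIntegrable (n := 2))
  have has : ∀ n, HasCompactSupport (approx u n) := fun n =>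
    (hasCompactSupport_cutoff n).mul_right
  have hgc : ∀ n, ContDiff ℝ 2 (g n) := fun n =>
    (contDiff_smoothAbs (hδpos n) (n := 2)).comp (hac n)
  have hgs : ∀ n, HasCompactSupport (g n) := fun n =>
    (has n).comp_left (smoothAbs_zero (hδpos n))
  have hfB : ∀ n, BddSupp (truncDensity f n) := bddSupp_truncDensity hf h0
  -- Density truncation, cutoff, mollification and smoothing of the absolute value all run along the
  -- same index. The bounds come from the dual estimate with `s = C / (n + 1)`, a bound for the
  -- gradient of the cutoff.
  refine integral_le_of_tendsto_ae (F := fun n x => 2 * c * (truncDensity f n x * g n x))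
    (b := fun n => (1 + C * δ n) * (∫ x, ‖G x‖ ^ 2) + (C * δ n + (C * δ n) ^ 2) *
      (∫ x, ‖u x‖ ^ 2) + c ^ 2 * (D / omega N)) (fun n => ?_) (fun n => ?_) ?_ (fun n => ?_) ?_
  · obtain ⟨hm, K, R, hK, hb⟩ := hfB n
    refine Integrable.const_mul ?_ _
    refine ((hgc n).continuous.integrable_of_hasCompactSupport (hgs n)).bdd_mul (c := K)
      hm.aestronglyMeasurable (Eventually.of_forall fun x => (hb x).trans ?_)
    exact indicator_le_self' (fun _ _ => hK) x
  · exact Eventually.of_forall fun x => mul_nonneg (by positivity)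
      (mul_nonneg (truncDensity_nonneg h0 n x) (smoothAbs_nonneg _))
  · filter_upwards [ae_tendsto_moll h.locallyIntegrable] with x hx
    refine ((tendsto_truncDensity f x).mul ?_).const_mul (2 * c)
    have h1 : Tendsto (fun n => approx u n x) atTop (𝓝 (1 * u x)) := (tendsto_cutoff x).mul hx
    rw [one_mul] at h1
    have h2 : Tendsto (fun n => smoothAbs (δ n) (approx u n x)) atTop
        (𝓝 (√(u x ^ 2 + 0 ^ 2) - 0)) := by
      unfold smoothAbs
      exact (((h1.pow 2).add (hδlim.pow 2)).sqrt).sub hδlim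
    simpa [Real.sqrt_sq_eq_abs] using h2
  · have h1 := two_mul_integral_mul_le hN (hfB n) (hgc n) (hgs n) c
    have h2 : coulReal (truncDensity f n) (truncDensity f n) ≤ D := by
      rw [coulReal_eq_toReal (hfB n).1 (hfB n).1 (truncDensity_nonneg h0 n)
        (truncDensity_nonneg h0 n)]
      refine ENNReal.toReal_mono hfin (coul_mono ?_ ?_) <;>
        exact fun x => ENNReal.ofReal_le_ofReal (truncDensity_le h0 n x)
    have h3 : ∫ x, ‖fderiv ℝ (g n) x‖ ^ 2 ≤ ∫ x, ‖fderiv ℝ (approx u n) x‖ ^ 2 :=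
      integral_norm_fderiv_smoothAbs_sq_le (hδpos n) ((hac n).of_le (by norm_num)) (has n)
    have h4 := integral_fderiv_approx_sq_le h hu2 hG2 n (hcut n)
    have h5 : c ^ 2 * (coulReal (truncDensity f n) (truncDensity f n) / omega N) ≤
        c ^ 2 * (D / omega N) := by gcongr
    rw [integral_const_mul]
    linarith
  · have h1 := hδlim.const_mul C
    have h2 := (((h1.const_add 1).mul_const (∫ x, ‖G x‖ ^ 2)).add
      ((h1.add (h1.pow 2)).mul_const (∫ x, ‖u x‖ ^ 2))).add_const (c ^ 2 * (D / omega N))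
    simpa using h2

/-! ### The Newtonian potential -/

/-- The Newtonian potential of a nonnegative density, without the normalisation. -/
noncomputable def newtonPot (f : Space N → ℝ≥0∞) (x : Space N) : ℝ≥0∞ :=
  ∫⁻ y, f y * ENNReal.ofReal (newton (x - y))

lemma measurable_newtonPot {f : Space N → ℝ≥0∞} (hf : Measurable f) :
    Measurable (newtonPot f) := by
  unfold newtonPot
  exact Measurable.lintegral_prod_right' (f := fun p : Space N × Space N =>
    f p.2 * ENNReal.ofReal (newton (p.1 - p.2))) (by fun_prop)

lemma coul_eq_lintegral (f : Space N → ℝ≥0∞) {g : Space N → ℝ≥0∞} (hg : Measurable g) :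
    coul f g = ∫⁻ x, f x * newtonPot g x := by
  unfold coul newtonPot
  refine lintegral_congr fun x => ?_
  rw [← lintegral_const_mul _ (by fun_prop)]
  simp_rw [mul_assoc]

lemma coul_mono_ae {f f' : Space N → ℝ≥0∞} (hf : ∀ᵐ x, f x ≤ f' x) : coul f f ≤ coul f' f' := by
  unfold coul
  refine lintegral_mono_ae ?_
  filter_upwards [hf] with x hx
  refine lintegral_mono_ae ?_
  filter_upwards [hf] with y hy
  gcongr

/-- The charge density `ρ u²`. -/
noncomputable abbrev charge (ρ u : Space N → ℝ) (x : Space N) : ℝ≥0∞ :=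
  ENNReal.ofReal (u x ^ 2 * ρ x)

lemma coulombEnergy_eq_coul {ρ u : Space N → ℝ} (hρ : ∀ x, 0 ≤ ρ x) :
    coulombEnergy ρ u = coul (charge ρ u) (charge ρ u) := by
  unfold coulombEnergy coul
  refine lintegral_congr fun x => lintegral_congr fun y => ?_
  have h := fun x => mul_nonneg (sq_nonneg (u x)) (hρ x)
  rw [div_eq_mul_inv, ENNReal.ofReal_mul (mul_nonneg (h x) (h y)), ENNReal.ofReal_mul (h x)]
  rfl

lemma potential_eq (hN : 3 ≤ N) {ρ u : Space N → ℝ} (hρm : Measurable ρ) (hum : Measurable u)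
    (hρ : ∀ x, 0 ≤ ρ x) (x : Space N) :
    potential ρ u x = (newtonPot (charge ρ u) x).toReal / omega N := by
  have hω := omega_pos hN
  have h1 : ∀ y, ρ y * u y ^ 2 / (omega N * ‖x - y‖ ^ (N - 2)) =
      (omega N)⁻¹ * (u y ^ 2 * ρ y * newton (x - y)) := by
    intro y
    rw [newton, div_eq_mul_inv, mul_inv]
    ring
  unfold potential
  simp_rw [h1]
  rw [integral_const_mul, integral_eq_lintegral_of_nonneg_ae
    (Eventually.of_forall fun y => mul_nonneg (mul_nonneg (sq_nonneg _) (hρ y)) (newton_nonneg _))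
    (by fun_prop), newtonPot, div_eq_inv_mul]
  congr 2
  refine lintegral_congr fun y => ?_
  rw [ENNReal.ofReal_mul (mul_nonneg (sq_nonneg _) (hρ y))]

lemma measurable_potential (hN : 3 ≤ N) {ρ u : Space N → ℝ} (hρm : Measurable ρ)
    (hum : Measurable u) (hρ : ∀ x, 0 ≤ ρ x) : Measurable (potential ρ u) := by
  have h : potential ρ u = fun x => (newtonPot (charge ρ u) x).toReal / omega N :=
    funext (potential_eq hN hρm hum hρ)
  rw [h]
  exact (measurable_newtonPot (by fun_prop)).ennreal_toReal.div_const _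

lemma potential_nonneg (hN : 3 ≤ N) {ρ u : Space N → ℝ} (hρm : Measurable ρ)
    (hum : Measurable u) (hρ : ∀ x, 0 ≤ ρ x) (x : Space N) : 0 ≤ potential ρ u x := by
  rw [potential_eq hN hρm hum hρ]
  exact div_nonneg ENNReal.toReal_nonneg (omega_pos hN).le

/-- Where the Newtonian potential is infinite, `potential` takes the default value `0`. Finite
energy makes charge times potential finite almost everywhere, so these points do not affect the
integral. -/
lemma integral_potential_mul (hN : 3 ≤ N) {ρ u : Space N → ℝ} (hρm : Measurable ρ)
    (hum : Measurable u) (hρ : ∀ x, 0 ≤ ρ x)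
    (hfin : coul (charge ρ u) (charge ρ u) ≠ ⊤) :
    (Integrable fun x => potential ρ u x * ρ x * u x * u x) ∧
    ∫ x, potential ρ u x * ρ x * u x * u x =
      (coul (charge ρ u) (charge ρ u)).toReal / omega N := by
  have hm : Measurable (charge ρ u) := by fun_prop
  have hVm := measurable_newtonPot hm
  have he : ∀ x, potential ρ u x * ρ x * u x * u x =
      (omega N)⁻¹ * (charge ρ u x * newtonPot (charge ρ u) x).toReal := by
    intro x
    rw [potential_eq hN hρm hum hρ, ENNReal.toReal_mul,
      ENNReal.toReal_ofReal (mul_nonneg (sq_nonneg _) (hρ x))]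
    ring
  rw [coul_eq_lintegral _ hm] at hfin ⊢
  have hmV : Measurable fun x => charge ρ u x * newtonPot (charge ρ u) x := hm.mul hVm
  have hae := ae_lt_top hmV hfin
  simp_rw [he]
  refine ⟨(integrable_toReal_of_lintegral_ne_top hmV.aemeasurable hfin).const_mul _, ?_⟩
  rw [integral_const_mul, integral_toReal hmV.aemeasurable hae, div_eq_inv_mul]

/-- Local boundedness of `ρ` bounds the density by a constant on a ball containing the support of
`χ`. -/
lemma coul_weight_ne_top (hN : 3 ≤ N) {ρ χ : Space N → ℝ} (hρ : MemLinftyLoc ρ)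
    (hχ0 : ∀ x, 0 ≤ χ x) (hχ1 : ∀ x, χ x ≤ 1) (hχs : HasCompactSupport χ) :
    coul (fun x => ENNReal.ofReal (χ x ^ 2 * ρ x)) (fun x => ENNReal.ofReal (χ x ^ 2 * ρ x))
      ≠ ⊤ := by
  obtain ⟨R, hR⟩ := hχs.isCompact.isBounded.subset_ball 0
  have hL := hρ (Metric.closedBall 0 R) (isCompact_closedBall _ _)
  set C := eLpNorm ρ ⊤ (volume.restrict (Metric.closedBall (0 : Space N) R)) with hC
  have hb : ∀ᵐ x : Space N, x ∈ Metric.closedBall 0 R → ‖ρ x‖ₑ ≤ C := by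
    rw [← ae_restrict_iff' Metric.isClosed_closedBall.measurableSet, hC, eLpNorm_exponent_top]
    exact ae_le_eLpNormEssSup
  refine ((coul_mono_ae (f' := (Metric.ball (0 : Space N) R).indicator fun _ => C) ?_).trans_lt
    (coul_lt_top hN hL.eLpNorm_lt_top.ne fun x => le_rfl)).ne
  filter_upwards [hb] with x hx
  by_cases hxR : x ∈ Metric.ball 0 R
  · rw [indicator_of_mem hxR]
    refine le_trans ?_ (hx (Metric.ball_subset_closedBall hxR))
    rw [← Real.enorm_abs, Real.enorm_of_nonneg (abs_nonneg _)]
    refine ENNReal.ofReal_le_ofReal ?_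
    calc χ x ^ 2 * ρ x ≤ χ x ^ 2 * |ρ x| := by gcongr; exact le_abs_self _
      _ ≤ 1 * |ρ x| := by gcongr; exact pow_le_one₀ (hχ0 x) (hχ1 x)
      _ = |ρ x| := one_mul _
  · have : χ x = 0 := by
      by_contra h
      exact hxR (hR (subset_tsupport _ h))
    simp [this]

/-- Since `|u| χ ≤ u² + χ²`, the integrand is controlled by the energy of `ρ u²` and the mixed
energy of `χ² ρ` with `ρ u²`. The latter is finite by positive definiteness of the kernel. -/
lemma integrable_potential_mul_cutoff (hN : 3 ≤ N) {ρ u χ : Space N → ℝ} (hρm : Measurable ρ)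
    (hum : Measurable u) (hρ : ∀ x, 0 ≤ ρ x) (hρL : MemLinftyLoc ρ)
    (hfin : coul (charge ρ u) (charge ρ u) ≠ ⊤) (hχm : Measurable χ)
    (hχ0 : ∀ x, 0 ≤ χ x) (hχ1 : ∀ x, χ x ≤ 1) (hχs : HasCompactSupport χ) :
    Integrable fun x => potential ρ u x * ρ x * u x * χ x := by
  have hω := omega_pos hN
  have hPm := measurable_potential hN hρm hum hρ
  have hm : Measurable (charge ρ u) := by fun_prop
  set h2 : Space N → ℝ≥0∞ := fun x => ENNReal.ofReal (χ x ^ 2 * ρ x) with hh2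
  have hm2 : Measurable h2 := by fun_prop
  have hVm := measurable_newtonPot hm
  have hc2 : coul h2 (charge ρ u) ≠ ⊤ := by
    have h := two_mul_coul_le hN hm2 hm
    have h3 : 2 * coul h2 (charge ρ u) < ⊤ := h.trans_lt (ENNReal.add_lt_top.2
      ⟨(coul_weight_ne_top hN hρL hχ0 hχ1 hχs).lt_top, hfin.lt_top⟩)
    intro h4
    simp [h4] at h3
  refine ⟨by fun_prop, ?_⟩
  have hle : ∀ x, ‖potential ρ u x * ρ x * u x * χ x‖ₑ ≤ ENNReal.ofReal (omega N)⁻¹ *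
      (charge ρ u x * newtonPot (charge ρ u) x + h2 x * newtonPot (charge ρ u) x) := by
    intro x
    have hP := potential_nonneg hN hρm hum hρ x
    rw [← Real.enorm_abs, Real.enorm_of_nonneg (abs_nonneg _), abs_mul, abs_mul, abs_mul,
      abs_of_nonneg hP, abs_of_nonneg (hρ x), abs_of_nonneg (hχ0 x)]
    have h1 : |u x| * χ x ≤ u x ^ 2 + χ x ^ 2 := by
      rw [← sq_abs (u x)]
      nlinarith [sq_nonneg (|u x| - χ x), sq_nonneg (|u x|), sq_nonneg (χ x)]
    calc ENNReal.ofReal (potential ρ u x * ρ x * |u x| * χ x)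
        ≤ ENNReal.ofReal ((omega N)⁻¹ * ((newtonPot (charge ρ u) x).toReal *
            (u x ^ 2 * ρ x + χ x ^ 2 * ρ x))) := by
          refine ENNReal.ofReal_le_ofReal ?_
          have h3 : potential ρ u x * ρ x * (|u x| * χ x) ≤
            potential ρ u x * ρ x * (u x ^ 2 + χ x ^ 2) :=
            mul_le_mul_of_nonneg_left h1 (mul_nonneg hP (hρ x))
          rw [potential_eq hN hρm hum hρ] at h3 ⊢
          calc _ = (newtonPot (charge ρ u) x).toReal / omega N * ρ x * (|u x| * χ x) := by ring
            _ ≤ _ := h3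
            _ = _ := by ring
      _ ≤ _ := by
          have h4 := fun y => mul_nonneg (sq_nonneg (u y)) (hρ y)
          have h5 := fun y => mul_nonneg (sq_nonneg (χ y)) (hρ y)
          rw [ENNReal.ofReal_mul (inv_nonneg.2 hω.le), ENNReal.ofReal_mul ENNReal.toReal_nonneg,
            ENNReal.ofReal_add (h4 x) (h5 x), ← add_mul, mul_comm (charge ρ u x + h2 x)]
          gcongr
          exact ENNReal.ofReal_toReal_le
  refine (lintegral_mono hle).trans_lt ?_
  rw [lintegral_const_mul _ (by fun_prop), lintegral_add_left (by fun_prop),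
    ← coul_eq_lintegral _ hm, ← coul_eq_lintegral _ hm]
  exact ENNReal.mul_lt_top ENNReal.ofReal_lt_top (ENNReal.add_lt_top.2 ⟨hfin.lt_top, hc2.lt_top⟩)

/-! ### The weak form of the equation -/

/-- The definition of the weak gradient is applied to the partial derivatives of `g`, which are
again test functions. -/
lemma HasWeakGradient.integral_mul_laplacian {u : Space N → ℝ} {G : Space N → Space N}
    (h : HasWeakGradient u G) {g : Space N → ℝ} (hg : ContDiff ℝ (⊤ : ℕ∞) g)
    (hs : HasCompactSupport g) : - ∫ x, u x * Δ g x = ∫ x, fderiv ℝ g x (G x) := by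
  have hc : ∀ i : Fin N, ContDiff ℝ (⊤ : ℕ∞) (fun y => fderiv ℝ g y (basisVec i)) := fun i =>
    (hg.fderiv_right (m := (⊤ : ℕ∞)) (by simp)).clm_apply contDiff_const
  have hcs : ∀ i : Fin N, HasCompactSupport (fun y => fderiv ℝ g y (basisVec i)) := fun i =>
    hasCompactSupport_fderiv_apply hs _
  have hi1 : ∀ i : Fin N, Integrable fun x => u x *
      fderiv ℝ (fun y => fderiv ℝ g y (basisVec i)) x (basisVec i) := fun i =>
    integrable_mul_of_locallyIntegrable h.locallyIntegrable
      (((hc i).continuous_fderiv (by simp)).clm_apply continuous_const)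
      (hasCompactSupport_fderiv_apply (hcs i) _)
  have hi2 : ∀ i : Fin N, Integrable fun x => G x i * fderiv ℝ g x (basisVec i) := fun i =>
    integrable_mul_of_locallyIntegrable (locallyIntegrable_coord h.locallyIntegrable_grad i)
      (hc i).continuous (hcs i)
  have hg2 : ContDiff ℝ 2 g := by exact_mod_cast contDiff_infty.1 hg 2
  simp_rw [laplacian_eq_sum hg2, Finset.mul_sum]
  have e : ∀ x, fderiv ℝ g x (G x) = ∑ i, G x i * fderiv ℝ g x (basisVec i) := fun x =>
    clm_apply_eq_sum _ _
  simp_rw [e]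
  rw [integral_finsetSum _ fun i _ => hi1 i, integral_finsetSum _ fun i _ => hi2 i,
    ← Finset.sum_neg_distrib]
  refine Finset.sum_congr rfl fun i _ => ?_
  rw [h.integral_mul_fderiv (hc i) (hcs i) i, neg_neg]

/-! ### Testing the equation with the solution -/

/-- A smooth bounded approximation of the identity function. -/
noncomputable def damp (ε s : ℝ) : ℝ := s / (1 + ε * s ^ 2)

/-- The derivative of `damp`. -/
noncomputable def dampDeriv (ε s : ℝ) : ℝ := (1 - ε * s ^ 2) / (1 + ε * s ^ 2) ^ 2

section

variable {ε : ℝ}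

lemma contDiff_damp (hε : 0 < ε) {n : ℕ∞} : ContDiff ℝ n (damp ε) := by
  unfold damp
  exact contDiff_id.div (by fun_prop) fun s => by positivity

lemma hasDerivAt_damp (hε : 0 < ε) (s : ℝ) : HasDerivAt (damp ε) (dampDeriv ε s) s := by
  have h1 : HasDerivAt (fun s : ℝ => 1 + ε * s ^ 2) (ε * (2 * s)) s := by
    simpa using (((hasDerivAt_id s).pow 2).const_mul ε).const_add 1
  refine ((hasDerivAt_id s).div h1 (by positivity)).congr_deriv ?_
  simp only [dampDeriv, id]
  congr 1
  ring

lemma continuous_dampDeriv (hε : 0 < ε) : Continuous (dampDeriv ε) := by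
  unfold dampDeriv
  exact Continuous.div (by fun_prop) (by fun_prop) fun s => by positivity

lemma abs_dampDeriv_le (hε : 0 < ε) (s : ℝ) : |dampDeriv ε s| ≤ 1 := by
  have h : 0 ≤ ε * s ^ 2 := by positivity
  rw [dampDeriv, abs_div, abs_of_nonneg (by positivity : 0 ≤ (1 + ε * s ^ 2) ^ 2)]
  refine div_le_one_of_le₀ (abs_le.2 ⟨?_, ?_⟩) (by positivity) <;> nlinarith

lemma abs_damp_le (hε : 0 < ε) (s : ℝ) : |damp ε s| ≤ |s| := by
  rw [damp, abs_div, abs_of_nonneg (by positivity : 0 ≤ 1 + ε * s ^ 2)]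
  exact div_le_self (abs_nonneg _) (by nlinarith [sq_nonneg s])

/-- The constant is not sharp: `|s| ≤ 1 + s²` gives `ε |s| ≤ ε + ε s² ≤ (1 + ε)(1 + ε s²)`. -/
lemma abs_damp_le_const (hε : 0 < ε) (s : ℝ) : |damp ε s| ≤ (1 + ε) / ε := by
  have h0 : 0 < 1 + ε * s ^ 2 := by positivity
  rw [damp, abs_div, abs_of_nonneg h0.le, div_le_div_iff₀ h0 hε]
  rw [← sq_abs s]
  have h1 : |s| ≤ 1 + |s| ^ 2 := by nlinarith [sq_nonneg (|s| - 1), abs_nonneg s]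
  have h2 : 0 ≤ ε ^ 2 * |s| ^ 2 := by positivity
  nlinarith [mul_le_mul_of_nonneg_left h1 hε.le]

end

lemma tendsto_damp (s : ℝ) :
    Tendsto (fun n : ℕ => damp (1 / ((n : ℝ) + 1)) s) atTop (𝓝 s) := by
  have h1 := ((tendsto_one_div_add_atTop_nhds_zero_nat (𝕜 := ℝ)).mul_const (s ^ 2)).const_add 1
  have h2 := (tendsto_const_nhds (x := s)).div h1 (by simp)
  simpa [damp, Pi.div_def] using h2

lemma tendsto_dampDeriv (s : ℝ) :
    Tendsto (fun n : ℕ => dampDeriv (1 / ((n : ℝ) + 1)) s) atTop (𝓝 1) := by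
  have h1 := (tendsto_one_div_add_atTop_nhds_zero_nat (𝕜 := ℝ)).mul_const (s ^ 2)
  have h2 := (h1.const_sub 1).div ((h1.const_add 1).pow 2) (by simp)
  simpa [dampDeriv, Pi.div_def] using h2

/-- The uniform bound on `damp ε` gives a majorant for any integrable `h`, which covers every term
of the tested equation except the one containing the gradient of the mollification. -/
lemma tendsto_integral_mul_damp_moll {u : Space N → ℝ} (hu : LocallyIntegrable u volume) {ε : ℝ}
    (hε : 0 < ε) {h : Space N → ℝ} (hh : Integrable h) :
    Tendsto (fun k => ∫ x, h x * damp ε (moll k u x)) atTop (𝓝 (∫ x, h x * damp ε (u x))) := by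
  have hT : Continuous (damp ε) := (contDiff_damp hε (n := 0)).continuous
  refine tendsto_integral_of_dominated_convergence (fun x => |h x| * ((1 + ε) / ε)) (fun k => ?_)
    (hh.abs.mul_const _) (fun k => Eventually.of_forall fun x => ?_) ?_
  · exact hh.1.mul (hT.comp (continuous_moll k hu)).aestronglyMeasurable
  · rw [norm_mul, Real.norm_eq_abs, Real.norm_eq_abs]
    gcongr
    exact abs_damp_le_const hε _
  · filter_upwards [ae_tendsto_moll hu] with x hx
    exact ((hT.tendsto _).comp hx).const_mul _

lemma integrable_mul_damp_moll {u : Space N → ℝ} (hu : LocallyIntegrable u volume) {ε : ℝ}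
    (hε : 0 < ε) {h : Space N → ℝ} (hh : Integrable h) (k : ℕ) :
    Integrable fun x => h x * damp ε (moll k u x) := by
  have hT : Continuous (damp ε) := (contDiff_damp hε (n := 0)).continuous
  exact hh.mul_bdd (c := (1 + ε) / ε) (hT.comp (continuous_moll k hu)).aestronglyMeasurable
    (Eventually.of_forall fun x => abs_damp_le_const hε _)

/-- The truncated regularised solution, used as a test function. -/
noncomputable def testApprox (u : Space N → ℝ) (ε : ℝ) (n k : ℕ) (x : Space N) : ℝ :=
  cutoff N n x * damp ε (moll k u x)

lemma fderiv_testApprox {u : Space N → ℝ} {G : Space N → Space N} (h : HasWeakGradient u G)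
    {ε : ℝ} (hε : 0 < ε) (n k : ℕ) (x v : Space N) :
    fderiv ℝ (testApprox u ε n k) x v =
      cutoff N n x * dampDeriv ε (moll k u x) * inner ℝ (moll k G x) v +
        fderiv ℝ (cutoff N n) x v * damp ε (moll k u x) := by
  have h1 : HasFDerivAt (cutoff N n) (fderiv ℝ (cutoff N n) x) x :=
    (((contDiff_cutoff n (m := 1)).differentiable (by norm_num)) x).hasFDerivAt
  have h2 : HasFDerivAt (moll k u) (fderiv ℝ (moll k u) x) x :=
    (((contDiff_moll k h.locallyIntegrable (n := 1)).differentiable (by norm_num)) x).hasFDerivAt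
  have h3 := (hasDerivAt_damp hε (moll k u x)).comp_hasFDerivAt x h2
  have h4 : fderiv ℝ (testApprox u ε n k) x = _ := (h1.mul h3).fderiv
  rw [h4, h.fderiv_moll]
  simp
  ring

lemma contDiff_testApprox {u : Space N → ℝ} (hu : LocallyIntegrable u volume)
    {ε : ℝ} (hε : 0 < ε) (n k : ℕ) : ContDiff ℝ (⊤ : ℕ∞) (testApprox u ε n k) :=
  (contDiff_cutoff n).mul ((contDiff_damp hε).comp (contDiff_moll k hu))

lemma hasCompactSupport_testApprox (u : Space N → ℝ) (ε : ℝ) (n k : ℕ) :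
    HasCompactSupport (testApprox u ε n k) := (hasCompactSupport_cutoff n).mul_right

lemma integrable_gradTerm {G H : Space N → Space N} (hG : AEStronglyMeasurable G volume)
    (hH : AEStronglyMeasurable H volume) (hG2 : Integrable fun x => ‖G x‖ ^ 2)
    (hH2 : Integrable fun x => ‖H x‖ ^ 2) {a : Space N → ℝ} (ha : AEStronglyMeasurable a volume)
    (ha1 : ∀ x, |a x| ≤ 1) :
    Integrable fun x => a x * inner ℝ (H x) (G x) := by
  refine (hG2.add hH2).mono' (ha.mul (hH.inner hG)) (Eventually.of_forall fun x => ?_)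
  have h1 := abs_real_inner_le_norm (H x) (G x)
  rw [Real.norm_eq_abs, abs_mul]
  have h2 : |a x| * |inner ℝ (H x) (G x)| ≤ 1 * (‖H x‖ * ‖G x‖) := by
    gcongr
    exact ha1 x
  simp only [Pi.add_apply]
  nlinarith [sq_nonneg (‖H x‖ - ‖G x‖), sq_nonneg ‖H x‖, sq_nonneg ‖G x‖]

lemma neg_le_mul_inner {a : ℝ} (ha : |a| ≤ 1) (v w : Space N) :
    0 ≤ a * inner ℝ v w + (‖w‖ ^ 2 + ‖v‖ ^ 2) / 2 := by
  have h1 := abs_real_inner_le_norm v w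
  have h3 : |a * inner ℝ v w| ≤ 1 * (‖v‖ * ‖w‖) := by
    rw [abs_mul]
    gcongr
  have h4 := neg_abs_le (a * inner ℝ v w)
  nlinarith [sq_nonneg (‖v‖ - ‖w‖)]

/-- Lower semicontinuity of the gradient term along mollifications. -/
lemma integral_gradTerm_le {u : Space N → ℝ} {G : Space N → Space N} (h : HasWeakGradient u G)
    (hG2 : Integrable fun x => ‖G x‖ ^ 2) {ε : ℝ} (hε : 0 < ε) (n : ℕ) {B : ℝ}
    (hB : Tendsto (fun k => ∫ x, cutoff N n x * dampDeriv ε (moll k u x) *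
      inner ℝ (moll k G x) (G x)) atTop (𝓝 B)) :
    ∫ x, cutoff N n x * dampDeriv ε (u x) * ‖G x‖ ^ 2 ≤ B := by
  have hT := continuous_dampDeriv hε
  have hcut : Continuous (cutoff N n) := (contDiff_cutoff n (m := 0)).continuous
  have hbd : ∀ s x, |cutoff N n x * dampDeriv ε s| ≤ 1 := by
    intro s x
    rw [abs_mul, abs_of_nonneg (cutoff_nonneg n x)]
    exact mul_le_one₀ (cutoff_le_one n x) (abs_nonneg _) (abs_dampDeriv_le hε s)
  have hGm := h.locallyIntegrable_grad.aestronglyMeasurable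
  have hGk := fun k => integrable_moll_sq k h.locallyIntegrable_grad hG2
  have hk : ∀ k, Integrable fun x => cutoff N n x * dampDeriv ε (moll k u x) *
      inner ℝ (moll k G x) (G x) := fun k =>
    integrable_gradTerm hGm (continuous_moll k h.locallyIntegrable_grad).aestronglyMeasurable hG2
      (hGk k).1 (hcut.mul (hT.comp (continuous_moll k h.locallyIntegrable))).aestronglyMeasurable
      fun x => hbd _ x
  have hlim : Integrable fun x => cutoff N n x * dampDeriv ε (u x) * ‖G x‖ ^ 2 := by
    have := integrable_gradTerm hGm hGm hG2 hG2 (a := fun x => cutoff N n x * dampDeriv ε (u x))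
      (hcut.aestronglyMeasurable.mul
        (hT.comp_aestronglyMeasurable h.locallyIntegrable.aestronglyMeasurable))
      fun x => hbd _ x
    simpa only [real_inner_self_eq_norm_sq] using this
  have hhalf : ∀ k, Integrable fun x => (‖G x‖ ^ 2 + ‖moll k G x‖ ^ 2) / 2 := fun k =>
    (hG2.add (hGk k).1).div_const 2
  -- Adding `(|G|² + |G_k|²) / 2` makes the integrand nonnegative, as Fatou's lemma requires. Its
  -- pointwise limit is `|G|²` and its integral is at most `∫ |G|²`, so it drops out of the final
  -- comparison.
  have key := integral_le_of_tendsto_ae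
    (F := fun k x => cutoff N n x * dampDeriv ε (moll k u x) * inner ℝ (moll k G x) (G x) +
      (‖G x‖ ^ 2 + ‖moll k G x‖ ^ 2) / 2)
    (f := fun x => cutoff N n x * dampDeriv ε (u x) * ‖G x‖ ^ 2 + ‖G x‖ ^ 2)
    (b := fun k => (∫ x, cutoff N n x * dampDeriv ε (moll k u x) * inner ℝ (moll k G x) (G x)) +
      ∫ x, ‖G x‖ ^ 2)
    (fun k => (hk k).add (hhalf k))
    (fun k => Eventually.of_forall fun x => neg_le_mul_inner (hbd _ x) _ _) ?_ (fun k => ?_)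
    (hB.add_const _)
  · rw [integral_add hlim hG2] at key
    linarith [key.2]
  · filter_upwards [ae_tendsto_moll h.locallyIntegrable, ae_tendsto_moll h.locallyIntegrable_grad]
      with x hx hGx
    have h1 := ((((hT.tendsto _).comp hx).const_mul (cutoff N n x)).mul
      (hGx.inner (𝕜 := ℝ) (tendsto_const_nhds (x := G x)))).add
      (((hGx.norm.pow 2).const_add (‖G x‖ ^ 2)).div_const 2)
    rw [real_inner_self_eq_norm_sq, add_self_div_two] at h1
    exact h1
  · rw [integral_add (hk k) (hhalf k), integral_div, integral_add hG2 (hGk k).1]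
    linarith [(hGk k).2]

/-- The equation tested with a truncation of the solution. -/
lemma truncated_energy_le (hN : 3 ≤ N) {q : ℝ} (hq : 1 < q) {ρ u : Space N → ℝ}
    {G : Space N → Space N} (hρm : Measurable ρ) (hum : Measurable u) (hρ : ∀ x, 0 ≤ ρ x)
    (hρL : MemLinftyLoc ρ) (hfin : coul (charge ρ u) (charge ρ u) ≠ ⊤)
    (h : HasWeakGradient u G) (hG2 : Integrable fun x => ‖G x‖ ^ 2)
    (huq : Integrable fun x => |u x| ^ (q + 1)) {lam : ℝ}
    (hu : IsDistributionalSolution ρ lam q u) {ε : ℝ} (hε : 0 < ε) (n : ℕ) :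
    (∫ x, cutoff N n x * dampDeriv ε (u x) * ‖G x‖ ^ 2) +
      (∫ x, fderiv ℝ (cutoff N n) x (G x) * damp ε (u x)) +
      (∫ x, u x * cutoff N n x * damp ε (u x)) +
      lam ^ 2 * (∫ x, potential ρ u x * ρ x * u x * cutoff N n x * damp ε (u x)) ≤
      ∫ x, |u x| ^ (q - 1) * u x * cutoff N n x * damp ε (u x) := by
  have hcut : Continuous (cutoff N n) := (contDiff_cutoff n (m := 0)).continuous
  have hcuts := hasCompactSupport_cutoff (N := N) n
  have hdc : Continuous (fderiv ℝ (cutoff N n)) :=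
    (contDiff_cutoff n (m := 1)).continuous_fderiv (by norm_num)
  have hul := h.locallyIntegrable
  have hGm := h.locallyIntegrable_grad.aestronglyMeasurable
  have i2 : Integrable fun x => fderiv ℝ (cutoff N n) x (G x) := by
    have e : ∀ x, fderiv ℝ (cutoff N n) x (G x) =
        ∑ i, G x i * fderiv ℝ (cutoff N n) x (basisVec i) := fun x => clm_apply_eq_sum _ _
    simp_rw [e]
    exact integrable_finsetSum _ fun i _ => integrable_mul_of_locallyIntegrable
      (locallyIntegrable_coord h.locallyIntegrable_grad i) (hdc.clm_apply continuous_const)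
      (hasCompactSupport_fderiv_apply hcuts _)
  have i3 : Integrable fun x => u x * cutoff N n x :=
    integrable_mul_of_locallyIntegrable hul hcut hcuts
  have i4 : Integrable fun x => potential ρ u x * ρ x * u x * cutoff N n x :=
    integrable_potential_mul_cutoff hN hρm hum hρ hρL hfin hcut.measurable (cutoff_nonneg n)
      (cutoff_le_one n) hcuts
  have i5 : Integrable fun x => |u x| ^ (q - 1) * u x * cutoff N n x := by
    refine (huq.add (hcut.integrable_of_hasCompactSupport hcuts)).mono'
      (by fun_prop : Measurable fun x => |u x| ^ (q - 1) * u x * cutoff N n x).aestronglyMeasurable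
      (Eventually.of_forall fun x => ?_)
    rw [norm_mul, norm_mul, Real.norm_of_nonneg (cutoff_nonneg n x),
      Real.norm_of_nonneg (Real.rpow_nonneg (abs_nonneg _) _), Real.norm_eq_abs]
    have h1 : |u x| ^ (q - 1) * |u x| = |u x| ^ q := by
      conv_lhs => rw [← Real.rpow_add_one' (abs_nonneg _) (by linarith)]
      congr 1; ring
    rw [h1, Pi.add_apply]
    have hc0 := cutoff_nonneg n x
    have hc1 := cutoff_le_one n x
    have hp0 : 0 ≤ |u x| ^ (q + 1) := Real.rpow_nonneg (abs_nonneg _) _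
    -- In both cases `|u|^q χ ≤ |u|^(q+1) + χ`.
    rcases le_total (|u x|) 1 with h2 | h2
    · have : |u x| ^ q ≤ 1 := Real.rpow_le_one (abs_nonneg _) h2 (by linarith)
      nlinarith
    · have : |u x| ^ q ≤ |u x| ^ (q + 1) := Real.rpow_le_rpow_of_exponent_le h2 (by linarith)
      nlinarith
  have i1 : ∀ k, Integrable fun x => cutoff N n x * dampDeriv ε (moll k u x) *
      inner ℝ (moll k G x) (G x) := fun k => by
    refine integrable_gradTerm hGm
      (continuous_moll k h.locallyIntegrable_grad).aestronglyMeasurable hG2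
      (integrable_moll_sq k h.locallyIntegrable_grad hG2).1
      (hcut.mul ((continuous_dampDeriv hε).comp (continuous_moll k hul))).aestronglyMeasurable
      fun x => ?_
    rw [abs_mul, abs_of_nonneg (cutoff_nonneg n x)]
    exact mul_le_one₀ (cutoff_le_one n x) (abs_nonneg _) (abs_dampDeriv_le hε _)
  -- The equation tested with `testApprox u ε n k`, solved for the only term that mollification does
  -- not leave under dominated convergence.
  have heq : ∀ k, ∫ x, cutoff N n x * dampDeriv ε (moll k u x) * inner ℝ (moll k G x) (G x) =
      (∫ x, |u x| ^ (q - 1) * u x * cutoff N n x * damp ε (moll k u x)) -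
      (∫ x, fderiv ℝ (cutoff N n) x (G x) * damp ε (moll k u x)) -
      (∫ x, u x * cutoff N n x * damp ε (moll k u x)) -
      lam ^ 2 * ∫ x, potential ρ u x * ρ x * u x * cutoff N n x * damp ε (moll k u x) := by
    intro k
    have hg := contDiff_testApprox hul hε n k
    have hs := hasCompactSupport_testApprox u ε n k
    have h1 := hu (toTestFn _ hg hs)
    rw [coe_toTestFn, h.integral_mul_laplacian hg hs] at h1
    simp_rw [fderiv_testApprox h hε] at h1
    rw [integral_add (i1 k) (integrable_mul_damp_moll hul hε i2 k)] at h1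
    simp only [testApprox, ← mul_assoc] at h1
    linarith
  have hB := (((tendsto_integral_mul_damp_moll hul hε i5).sub
    (tendsto_integral_mul_damp_moll hul hε i2)).sub
    (tendsto_integral_mul_damp_moll hul hε i3)).sub
    ((tendsto_integral_mul_damp_moll hul hε i4).const_mul (lam ^ 2))
  have key := integral_gradTerm_le h hG2 hε n (hB.congr fun k => (heq k).symm)
  linarith

/-- The Nehari inequality for a solution. -/
theorem energy_le (hN : 3 ≤ N) {q : ℝ} (hq : 1 < q) {ρ u : Space N → ℝ}
    {G : Space N → Space N} (hρm : Measurable ρ) (hum : Measurable u) (hρ : ∀ x, 0 ≤ ρ x)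
    (hρL : MemLinftyLoc ρ) (hfin : coul (charge ρ u) (charge ρ u) ≠ ⊤)
    (h : HasWeakGradient u G) (hu2 : Integrable fun x => ‖u x‖ ^ 2)
    (hG2 : Integrable fun x => ‖G x‖ ^ 2)
    (huq : Integrable fun x => |u x| ^ (q + 1)) {lam : ℝ}
    (hu : IsDistributionalSolution ρ lam q u) :
    (∫ x, ‖G x‖ ^ 2) + (∫ x, ‖u x‖ ^ 2) +
      lam ^ 2 * ((coul (charge ρ u) (charge ρ u)).toReal / omega N) ≤
      ∫ x, |u x| ^ (q + 1) := by
  obtain ⟨C, hC, hcutd⟩ := exists_norm_fderiv_cutoff_le N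
  obtain ⟨iP, eP⟩ := integral_potential_mul hN hρm hum hρ hfin
  have hPm := measurable_potential hN hρm hum hρ
  have hGm := h.locallyIntegrable_grad.aestronglyMeasurable
  have hεpos : ∀ n : ℕ, 0 < 1 / ((n : ℝ) + 1) := fun n => by positivity
  have hε1 : ∀ n : ℕ, 1 / ((n : ℝ) + 1) ≤ 1 := fun n => by
    rw [div_le_one (by positivity)]
    linarith [(Nat.cast_nonneg n : (0 : ℝ) ≤ n)]
  have hcut : ∀ n, Continuous (cutoff N n) := fun n => (contDiff_cutoff n (m := 0)).continuous
  have hdm : ∀ n : ℕ, Measurable fun x => damp (1 / ((n : ℝ) + 1)) (u x) := fun n =>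
    (contDiff_damp (hεpos n) (n := 0)).continuous.measurable.comp hum
  have hterm : ∀ {a : Space N → ℝ}, AEStronglyMeasurable a volume →
      Integrable (fun x => a x * u x) →
      Tendsto (fun n : ℕ => ∫ x, a x * cutoff N n x * damp (1 / ((n : ℝ) + 1)) (u x)) atTop
        (𝓝 (∫ x, a x * u x)) := by
    intro a ha hai
    refine tendsto_integral_of_dominated_convergence (fun x => ‖a x * u x‖) (fun n => ?_) hai.norm
      (fun n => Eventually.of_forall fun x => ?_) (Eventually.of_forall fun x => ?_)
    · exact (ha.mul (hcut n).aestronglyMeasurable).mul (hdm n).aestronglyMeasurable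
    · rw [norm_mul, norm_mul, norm_mul, Real.norm_of_nonneg (cutoff_nonneg n x)]
      refine mul_le_mul ?_ (abs_damp_le (hεpos n) _) (norm_nonneg _) (norm_nonneg _)
      exact mul_le_of_le_one_right (norm_nonneg _) (cutoff_le_one n x)
    · simpa using ((tendsto_cutoff x).const_mul (a x)).mul (tendsto_damp (u x))
  have t3 := hterm hum.aestronglyMeasurable (by simpa [← sq] using hu2)
  have t4 := hterm (a := fun x => potential ρ u x * ρ x * u x)
    (by fun_prop : Measurable fun x => potential ρ u x * ρ x * u x).aestronglyMeasurable iP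
  have e5 : ∀ x, |u x| ^ (q - 1) * u x * u x = |u x| ^ (q + 1) := by
    intro x
    rw [mul_assoc, ← sq, ← sq_abs, ← Real.rpow_natCast,
      ← Real.rpow_add' (abs_nonneg _) (by push_cast; linarith)]
    congr 1; push_cast; ring
  have t5 := hterm (a := fun x => |u x| ^ (q - 1) * u x)
    (by fun_prop : Measurable fun x => |u x| ^ (q - 1) * u x).aestronglyMeasurable
    (by simpa only [e5] using huq)
  simp_rw [e5] at t5
  have t1 : Tendsto (fun n : ℕ => ∫ x, cutoff N n x * dampDeriv (1 / ((n : ℝ) + 1)) (u x) *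
      ‖G x‖ ^ 2) atTop (𝓝 (∫ x, ‖G x‖ ^ 2)) := by
    refine tendsto_integral_of_dominated_convergence (fun x => ‖G x‖ ^ 2) (fun n => ?_) hG2
      (fun n => Eventually.of_forall fun x => ?_) (Eventually.of_forall fun x => ?_)
    · exact ((hcut n).measurable.mul
        ((continuous_dampDeriv (hεpos n)).measurable.comp hum)).aestronglyMeasurable.mul
        (hGm.norm.pow 2)
    · rw [norm_mul, norm_mul, Real.norm_of_nonneg (cutoff_nonneg n x), norm_pow, norm_norm]
      exact mul_le_of_le_one_left (by positivity) (mul_le_one₀ (cutoff_le_one n x)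
        (norm_nonneg _) (abs_dampDeriv_le (hεpos n) _))
    · simpa using ((tendsto_cutoff x).mul (tendsto_dampDeriv (u x))).mul_const (‖G x‖ ^ 2)
  -- The cross term vanishes because the gradient of the cutoff is `O(1 / (n + 1))` while `|G| |u|`
  -- is integrable.
  have t2 : Tendsto (fun n : ℕ => ∫ x, fderiv ℝ (cutoff N n) x (G x) *
      damp (1 / ((n : ℝ) + 1)) (u x)) atTop (𝓝 (∫ _x : Space N, (0 : ℝ))) := by
    have hbd : ∀ (n : ℕ) (x : Space N), ‖fderiv ℝ (cutoff N n) x (G x) *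
        damp (1 / ((n : ℝ) + 1)) (u x)‖ ≤ C * (1 / ((n : ℝ) + 1)) * (‖G x‖ * ‖u x‖) := by
      intro n x
      rw [norm_mul, ← mul_assoc]
      refine mul_le_mul ?_ (abs_damp_le (hεpos n) _) (norm_nonneg _) (by positivity)
      refine ((fderiv ℝ (cutoff N n) x).le_opNorm _).trans ?_
      gcongr
      exact hcutd n x
    refine tendsto_integral_of_dominated_convergence (fun x => C * (‖G x‖ ^ 2 + ‖u x‖ ^ 2))
      (fun n => ?_) ((hG2.add hu2).const_mul C) (fun n => Eventually.of_forall fun x => ?_)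
      (Eventually.of_forall fun x => ?_)
    · have hdc : Continuous (fderiv ℝ (cutoff N n)) :=
        (contDiff_cutoff n (m := 1)).continuous_fderiv (by norm_num)
      have h1 : AEStronglyMeasurable (fun x => fderiv ℝ (cutoff N n) x (G x)) volume :=
        (isBoundedBilinearMap_apply (𝕜 := ℝ) (E := Space N) (F := ℝ)).continuous.comp_aestronglyMeasurable
          (hdc.aestronglyMeasurable.prodMk hGm)
      exact h1.mul (hdm n).aestronglyMeasurable
    · refine (hbd n x).trans ?_
      rw [mul_assoc]
      refine mul_le_mul_of_nonneg_left ?_ hC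
      calc 1 / ((n : ℝ) + 1) * (‖G x‖ * ‖u x‖) ≤ 1 * (‖G x‖ * ‖u x‖) := by
            gcongr
            exact hε1 n
        _ ≤ _ := by nlinarith [sq_nonneg (‖G x‖ - ‖u x‖), sq_nonneg ‖G x‖, sq_nonneg ‖u x‖]
    · refine squeeze_zero_norm (hbd · x) ?_
      simpa using ((tendsto_one_div_add_atTop_nhds_zero_nat (𝕜 := ℝ)).const_mul C).mul_const
        (‖G x‖ * ‖u x‖)
  have key := le_of_tendsto_of_tendsto' (((t1.add t2).add t3).add (t4.const_mul (lam ^ 2))) t5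
    fun n => truncated_energy_le hN hq hρm hum hρ hρL hfin h hG2 huq hu (hεpos n) n
  rw [eP] at key
  have e3 : ∫ x, u x * u x = ∫ x, ‖u x‖ ^ 2 := by simp [← sq]
  rw [e3, integral_zero, add_zero] at key
  exact key

/-! ### Invariance under modification on null sets -/

lemma HasWeakGradient.congr {u u' : Space N → ℝ} {G : Space N → Space N}
    (h : HasWeakGradient u G) (hu : u =ᵐ[volume] u') : HasWeakGradient u' G where
  locallyIntegrable := h.locallyIntegrable.congr hu
  locallyIntegrable_grad := h.locallyIntegrable_grad
  integral_eq η i := by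
    rw [← h.integral_eq η i]
    refine integral_congr_ae ?_
    filter_upwards [hu] with x hx
    rw [hx]

lemma coulombEnergy_congr {ρ ρ' u u' : Space N → ℝ} (hρ : ρ =ᵐ[volume] ρ')
    (hu : u =ᵐ[volume] u') : coulombEnergy ρ u = coulombEnergy ρ' u' := by
  unfold coulombEnergy
  refine lintegral_congr_ae ?_
  filter_upwards [hρ, hu] with x hx hx'
  refine lintegral_congr_ae ?_
  filter_upwards [hρ, hu] with y hy hy'
  rw [hx, hx', hy, hy']

/-- Equality holds at every point, because the data enter only under the integral sign. -/
lemma potential_congr {ρ ρ' u u' : Space N → ℝ} (hρ : ρ =ᵐ[volume] ρ')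
    (hu : u =ᵐ[volume] u') : potential ρ u = potential ρ' u' := by
  funext x
  refine integral_congr_ae ?_
  filter_upwards [hρ, hu] with y hy hy'
  rw [hy, hy']

lemma IsDistributionalSolution.congr {ρ ρ' u u' : Space N → ℝ} {lam q : ℝ}
    (h : IsDistributionalSolution ρ lam q u) (hρ : ρ =ᵐ[volume] ρ') (hu : u =ᵐ[volume] u') :
    IsDistributionalSolution ρ' lam q u' := by
  intro η
  have e1 : ∫ x, u' x * Δ (η : Space N → ℝ) x = ∫ x, u x * Δ (η : Space N → ℝ) x := by
    refine integral_congr_ae ?_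
    filter_upwards [hu] with x hx
    rw [hx]
  have e2 : ∫ x, u' x * η x = ∫ x, u x * η x := by
    refine integral_congr_ae ?_
    filter_upwards [hu] with x hx
    rw [hx]
  have e3 : ∫ x, potential ρ' u' x * ρ' x * u' x * η x =
      ∫ x, potential ρ u x * ρ x * u x * η x := by
    rw [potential_congr hρ hu]
    refine integral_congr_ae ?_
    filter_upwards [hu, hρ] with x hx hx'
    rw [hx, hx']
  have e4 : ∫ x, |u' x| ^ (q - 1) * u' x * η x = ∫ x, |u x| ^ (q - 1) * u x * η x := by
    refine integral_congr_ae ?_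
    filter_upwards [hu] with x hx
    rw [hx]
  rw [e1, e2, e3, e4]
  exact h η

lemma MemLinftyLoc.congr {ρ ρ' : Space N → ℝ} (h : MemLinftyLoc ρ) (hρ : ρ =ᵐ[volume] ρ') :
    MemLinftyLoc ρ' := fun K hK => (h K hK).ae_eq (ae_restrict_of_ae hρ)

lemma MemLinftyLoc.aestronglyMeasurable {ρ : Space N → ℝ} (h : MemLinftyLoc ρ) :
    AEStronglyMeasurable ρ volume := by
  have h1 := aestronglyMeasurable_iUnion_iff.2 fun n : ℕ =>
    (h (Metric.closedBall 0 n) (isCompact_closedBall _ _)).1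
  rwa [Metric.iUnion_closedBall_nat, Measure.restrict_univ] at h1

/-! ### Finite energies, comparison of powers, and the conclusion -/

lemma MemE.exists_grad {ρ u : Space N → ℝ} {lam : ℝ} (hlam : 0 < lam) (h : MemE ρ lam u) :
    ∃ G : Space N → Space N, HasWeakGradient u G ∧ (Integrable fun x => ‖u x‖ ^ 2) ∧
      (Integrable fun x => ‖G x‖ ^ 2) ∧ coulombEnergy ρ u ≠ ⊤ := by
  obtain ⟨G, hG, hE⟩ := h
  rw [normE, ENNReal.rpow_lt_top_iff_of_pos (by norm_num), ENNReal.add_lt_top] at hE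
  obtain ⟨h1, h2⟩ := hE
  have hum := hG.locallyIntegrable.aestronglyMeasurable
  have hGm := hG.locallyIntegrable_grad.aestronglyMeasurable
  refine ⟨G, hG, ⟨hum.norm.pow 2, ?_⟩, ⟨hGm.norm.pow 2, ?_⟩, fun h3 => ?_⟩
  · rw [hasFiniteIntegral_iff_ofReal (Eventually.of_forall fun x => by positivity)]
    refine (lintegral_mono fun x => ENNReal.ofReal_le_ofReal ?_).trans_lt h1
    rw [Real.norm_eq_abs, sq_abs]
    nlinarith [sq_nonneg ‖G x‖]
  · rw [hasFiniteIntegral_iff_ofReal (Eventually.of_forall fun x => by positivity)]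
    refine (lintegral_mono fun x => ENNReal.ofReal_le_ofReal ?_).trans_lt h1
    nlinarith [sq_nonneg (u x)]
  -- Positivity of `lam` is used here: with `lam = 0` the product `0 * ⊤ = 0` would hide an infinite
  -- Coulomb energy.
  · rw [h3, ENNReal.top_rpow_of_pos (by norm_num), ENNReal.mul_top (by simpa using hlam)] at h2
    exact lt_irrefl _ h2

/-- The exponent lies between `2` and `3`, so the power is at most `t²` for `t ≤ 1` and at most `t³`
for `t ≥ 1`; the other term makes the inequality strict. -/
lemma rpow_lt_sq_add_cube {q t : ℝ} (hq : 1 < q) (hq2 : q ≤ 2) (ht : 0 < t) :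
    t ^ (q + 1) < t ^ 2 + t ^ 3 := by
  have h2 : 0 < t ^ 2 := by positivity
  have h3 : 0 < t ^ 3 := by positivity
  rcases le_total t 1 with h | h
  · have := Real.rpow_le_rpow_of_exponent_ge ht h (by push_cast; linarith : ((2 : ℕ) : ℝ) ≤ q + 1)
    rw [Real.rpow_natCast] at this
    linarith
  · have := Real.rpow_le_rpow_of_exponent_le h (by push_cast; linarith : q + 1 ≤ ((3 : ℕ) : ℝ))
    rw [Real.rpow_natCast] at this
    linarith

/-- Nonexistence for measurable data. -/
theorem ae_eq_zero_of_measurable (hN : 3 ≤ N) {q : ℝ} (hq : 1 < q) (hq2 : q ≤ 2)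
    {ρ u : Space N → ℝ} {G : Space N → Space N} (hρm : Measurable ρ) (hum : Measurable u)
    (hρ : ∀ x, 1 ≤ ρ x) (hρL : MemLinftyLoc ρ) (hfin : coulombEnergy ρ u ≠ ⊤)
    (h : HasWeakGradient u G) (hu2 : Integrable fun x => ‖u x‖ ^ 2)
    (hG2 : Integrable fun x => ‖G x‖ ^ 2)
    (huq : Integrable fun x => |u x| ^ (q + 1)) {lam : ℝ} (hlam : 1 / 2 ≤ lam)
    (hu : IsDistributionalSolution ρ lam q u) : u =ᵐ[volume] 0 := by
  have hρ0 : ∀ x, 0 ≤ ρ x := fun x => zero_le_one.trans (hρ x)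
  rw [coulombEnergy_eq_coul hρ0] at hfin
  have h1 := energy_le hN hq hρm hum hρ0 hρL hfin h hu2 hG2 huq hu
  -- The choice `c = lam` makes the right side equal to the gradient and Coulomb terms of the Nehari
  -- inequality, which then cancel.
  obtain ⟨hi, h2⟩ := two_mul_integral_mul_abs_le hN h hu2 hG2
    (f := fun x => u x ^ 2 * ρ x) (by fun_prop) (fun x => mul_nonneg (sq_nonneg _) (hρ0 x)) hfin
    (c := lam) (by linarith)
  have hcube : ∀ x, |u x| ^ 3 ≤ 2 * lam * (u x ^ 2 * ρ x * |u x|) := by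
    intro x
    -- The thresholds `lam ≥ 1 / 2` and `ρ ≥ 1` enter precisely here.
    have h3 : 1 ≤ 2 * lam * ρ x := by nlinarith [hρ x]
    calc |u x| ^ 3 = 1 * |u x| ^ 3 := (one_mul _).symm
      _ ≤ 2 * lam * ρ x * |u x| ^ 3 := by gcongr
      _ = _ := by rw [← sq_abs (u x)]; ring
  set F : Space N → ℝ := fun x =>
    ‖u x‖ ^ 2 + 2 * lam * (u x ^ 2 * ρ x * |u x|) - |u x| ^ (q + 1) with hF
  have hpos : ∀ x, u x ≠ 0 → 0 < F x := by
    intro x hx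
    have h3 := rpow_lt_sq_add_cube hq hq2 (abs_pos.2 hx)
    have h4 := hcube x
    simp only [hF, Real.norm_eq_abs]
    linarith
  have hF0 : ∀ x, 0 ≤ F x := by
    intro x
    by_cases hx : u x = 0
    · simp [hF, hx, Real.zero_rpow (by linarith : q + 1 ≠ 0)]
    · exact (hpos x hx).le
  have hFi : Integrable F := (hu2.add hi).sub huq
  have hint : ∫ x, F x = 0 := by
    refine le_antisymm ?_ (integral_nonneg hF0)
    have h5 : ∫ x, F x = (∫ x, ‖u x‖ ^ 2) + (∫ x, 2 * lam * (u x ^ 2 * ρ x * |u x|)) -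
        ∫ x, |u x| ^ (q + 1) := by
      rw [← integral_add hu2 hi]
      exact integral_sub (hu2.add hi) huq
    rw [h5]
    linarith
  rw [integral_eq_zero_iff_of_nonneg hF0 hFi] at hint
  filter_upwards [hint] with x hx
  by_contra hne
  exact (hpos x hne).ne' hx

end SchrodingerPoisson

theorem mainTheorem10 (N : ℕ) (hN : 3 ≤ N) (q : ℝ) (hq : q ∈ Set.Ioc (1 : ℝ) 2)
    (ρ : SchrodingerPoisson.Space N → ℝ) (hρ : SchrodingerPoisson.MemLinftyLoc ρ)
    (hρ1 : ∀ᵐ x ∂volume, 1 ≤ ρ x) (lam : ℝ) (hlam : 1 / 2 ≤ lam)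
    (u : SchrodingerPoisson.Space N → ℝ) (huE : SchrodingerPoisson.MemE ρ lam u)
    (huL : MemLp u (ENNReal.ofReal (q + 1)) volume)
    (hu : SchrodingerPoisson.IsDistributionalSolution ρ lam q u) :
    u =ᵐ[volume] 0 := by
  obtain ⟨G, hG, hu2, hG2, hfin⟩ := huE.exists_grad (by linarith)
  have hum := huL.1
  have hρm := hρ.aestronglyMeasurable
  have hq0 : 0 < q + 1 := by linarith [hq.1]
  have hue : u =ᵐ[volume] hum.mk u := hum.ae_eq_mk
  -- The maximum with `1` gives a measurable representative that satisfies the lower bound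
  -- everywhere, not only almost everywhere.
  have hρe : ρ =ᵐ[volume] fun x => max 1 (hρm.mk ρ x) := by
    filter_upwards [hρm.ae_eq_mk, hρ1] with x hx hx1
    rw [← hx, max_eq_right hx1]
  have huq : Integrable fun x => |u x| ^ (q + 1) := by
    have h1 := huL.integrable_norm_rpow (by simpa using hq0) ENNReal.ofReal_ne_top
    simpa only [ENNReal.toReal_ofReal hq0.le, Real.norm_eq_abs] using h1
  refine hue.trans (SchrodingerPoisson.ae_eq_zero_of_measurable hN hq.1 hq.2 (G := G)
    (measurable_const.max hρm.stronglyMeasurable_mk.measurable)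
    hum.stronglyMeasurable_mk.measurable (fun x => le_max_left _ _) (hρ.congr hρe) ?_
    (hG.congr hue) ?_ hG2 ?_ hlam (hu.congr hρe hue))
  · rwa [← SchrodingerPoisson.coulombEnergy_congr hρe hue]
  · refine hu2.congr ?_
    filter_upwards [hue] with x hx
    rw [← hx]
  · refine huq.congr ?_
    filter_upwards [hue] with x hx
    rw [← hx]
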